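/- Graphs are finite, undirected and loopless; parallel edges are allowed. For a graph $G$ let $N_G(v)$ be the set of neighbours of $v$, and let $d_G(v)$ be the number of edges incident with $v$ (so $d_G(v)=|N_G(v)|$ if $G$ is simple). Let $n=|V(G)|$. A labeling of $G$ is a bijection $f:V(G)\to\{1,\dots,n\}$; it identifies $V(G)$ with $\{1,\dots,n\}$. The out-degree vector of an orientation $D$ of $G$ is $(s_1,\dots,s_n)$, where $s_i$ is the number of edges directed away from vertex $i$. Let $s^r_G$ (respectively $s^l_G$) be the out-degree vector of the orientation in which every edge is directed from its smaller to its larger end (respectively from its larger to its smaller end). For nonnegative integer vectors $s,t$ of dimension $n$ write $s\preccurlyeq t$ if $\sum_{i=1}^k s_i\le\sum_{i=1}^k t_i$ for all $1\le k\le n$, with equality for $k=n$. The labeling $f$ is degree complete if every nonnegative integer vector $s$ with $s^l_G\preccurlyeq s\preccurlyeq s^r_G$ and $s_i\le d_G(i)$ for all $i$ is the out-degree vector of some orientation of $G$. Let $T_1$ be the tree obtained by attaching three paths of length $2$ to one vertex, $T_2$ a triangle with one pendant edge attached to each of its three vertices, and $C_k$ the cycle of length $k$. Let $X_1(G)=\{v\in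 V(G): |N_G(v)|=1\}$. Fix an arbitrary order $v_1,\dots,v_n$ of the vertices and an arbitrary order $e_1,\dots,e_m$ of the edges of $G$. The set $X_2(G)$ is built from $\emptyset$ by going through $i=1,\dots,n$ and adding $v_i$ if $v_i$ has exactly two neighbours $u,v$, these are adjacent, $v_i$ is the unique common neighbour of $u$ and $v$, and neither $u$ nor $v$ is already in $X_2(G)$. The set $F(G)$ is built from $\emptyset$ by going through $j=1,\dots,m$ and adding $e_j$, with ends $u,w$, if $u$ and $w$ have a unique common neighbour $v$, $|N_G(v)|=2$, and no edge joining $u$ and $v$ or $v$ and $w$ is already in $F(G)$. A graph is a disjoint union of paths if it is the union of pairwise vertex-disjoint subgraphs (possibly none), each of which has vertices that can be listed as pairwise distinct $v_1,\dots,v_{p+1}$ ($p\ge 0$) such that precisely the consecutive ones are adjacent (consecutive vertices may be joined by parallel edges, so for a simple graph these are paths in the usual sense). **Theorem.** Let $G$ be a finite loopless graph, possibly with parallel edges, with any orders of $V(G)$ and $E(G)$ used for $X_2(G)$ and $F(G)$. The following statements are equivalent. (i) $G$ has a degree complete labeling. (ii) $G$ does not contain a subgraph isomorphic to $T_1$,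 $T_2$ or $C_k$ for any $k\ge 4$. (iii) $G-X_1(G)-X_2(G)$ is a disjoint union of paths. (iv) $G-X_1(G)-F(G)$ is a disjoint union of paths. -/

import Mathlib

open scoped Graph

namespace DegreeLabeling

universe u v u' v'

variable {α : Type u} {β : Type v} {α' : Type u'} {β' : Type v'}

/-! ### Neighbours and degrees -/

/-- The set of neighbours of `x`. -/
def neighborSet (G : Graph α β) (x : α) : Set α := {y | G.Adj x y}

/-- The number of distinct neighbours of `x`. -/
noncomputable def numNeighbors (G : Graph α β) (x : α) : ℕ := (neighborSet G x).ncard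

/-- The number of edges at `x`, parallel edges counted separately (for loopless graphs). -/
noncomputable def edgeDegree (G : Graph α β) (x : α) : ℕ := (G.incidenceSet x).ncard

/-- The set of common neighbours of `x` and `y`. -/
def commonNeighbors (G : Graph α β) (x y : α) : Set α := neighborSet G x ∩ neighborSet G y

/-! ### Orientations and labelings -/

/-- An orientation of `G`: every edge is directed from one of its ends to the other. -/
structure Orientation (G : Graph α β) where
  tail : E(G) → V(G)
  head : E(G) → V(G)
  isLink : ∀ e, G.IsLink e.1 (tail e).1 (head e).1

/-- The out-degree of `x`: the number of edges directed away from `x`. -/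
noncomputable def Orientation.outDegree {G : Graph α β} (D : Orientation G) (x : V(G)) : ℕ :=
  {e : E(G) | D.tail e = x}.ncard

/-- Reverse all arcs. -/
def Orientation.reverse {G : Graph α β} (D : Orientation G) : Orientation G where
  tail := D.head
  head := D.tail
  isLink e := (D.isLink e).symm

/-- A labeling: a bijection of the vertex set with `{0, …, n - 1}`, `n` the order of `G`. -/
abbrev Labeling (G : Graph α β) : Type u := V(G) ≃ Fin V(G).ncard

/-- The vector of out-degrees, indexed by the labels. -/
noncomputable def Orientation.outDegreeVector {G : Graph α β} (D : Orientation G)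
    (f : Labeling G) : Fin V(G).ncard → ℕ :=
  fun i => D.outDegree (f.symm i)

theorem exists_ordered_ends (G : Graph α β) [G.Loopless] (f : Labeling G) (e : E(G)) :
    ∃ p : V(G) × V(G), G.IsLink e.1 p.1.1 p.2.1 ∧ f p.1 < f p.2 := by
  obtain ⟨x, y, h⟩ := G.exists_isLink_of_mem_edgeSet e.2
  have hne : f ⟨x, h.left_mem⟩ ≠ f ⟨y, h.right_mem⟩ := fun hf =>
    h.ne (congrArg Subtype.val (f.injective hf))
  rcases lt_or_gt_of_ne hne with hlt | hlt
  · exact ⟨(⟨x, h.left_mem⟩, ⟨y, h.right_mem⟩), h, hlt⟩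
  · exact ⟨(⟨y, h.right_mem⟩, ⟨x, h.left_mem⟩), h.symm, hlt⟩

/-- All edges are directed from the smaller to the larger label. -/
noncomputable def rightOrientation (G : Graph α β) [G.Loopless] (f : Labeling G) :
    Orientation G where
  tail e := (exists_ordered_ends G f e).choose.1
  head e := (exists_ordered_ends G f e).choose.2
  isLink e := (exists_ordered_ends G f e).choose_spec.1

/-- All edges are directed from the larger to the smaller label. -/
noncomputable def leftOrientation (G : Graph α β) [G.Loopless] (f : Labeling G) :
    Orientation G :=
  (rightOrientation G f).reverse

theorem rightOrientation_lt (G : Graph α β) [G.Loopless] (f : Labeling G) (e : E(G)) :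
    f ((rightOrientation G f).tail e) < f ((rightOrientation G f).head e) :=
  (exists_ordered_ends G f e).choose_spec.2

/-- The dominance-type order: all partial sums are bounded, and the total sums agree. -/
def Dominated {n : ℕ} (s t : Fin n → ℕ) : Prop :=
  (∀ k : Fin n, ∑ i ∈ Finset.Iic k, s i ≤ ∑ i ∈ Finset.Iic k, t i) ∧ ∑ i, s i = ∑ i, t i

/-- `G` with the labeling `f` is degree complete. -/
def IsDegreeComplete (G : Graph α β) [G.Loopless] (f : Labeling G) : Prop :=
  ∀ s : Fin V(G).ncard → ℕ,
    Dominated ((leftOrientation G f).outDegreeVector f) s →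
    Dominated s ((rightOrientation G f).outDegreeVector f) →
    (∀ i, s i ≤ edgeDegree G (f.symm i)) →
    ∃ D : Orientation G, D.outDegreeVector f = s

/-- Some labeling of `G` is degree complete. -/
def HasDegreeCompleteLabeling (G : Graph α β) [G.Loopless] : Prop :=
  ∃ f : Labeling G, IsDegreeComplete G f

/-! ### Forbidden subgraphs -/

/-- Isomorphism of multigraphs. -/
def Isomorphic (G : Graph α β) (H : Graph α' β') : Prop :=
  ∃ (φ : V(G) ≃ V(H)) (ψ : E(G) ≃ E(H)),
    ∀ (e : E(G)) (x y : V(G)), G.IsLink e.1 x.1 y.1 ↔ H.IsLink (ψ e).1 (φ x).1 (φ y).1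

/-- `G` has a subgraph isomorphic to the simple graph `K`. -/
def HasSubgraphIsomorphicTo (G : Graph α β) {W : Type} (K : SimpleGraph W) : Prop :=
  ∃ H : Graph α β, H ≤ G ∧ Isomorphic H (Graph.ofSimpleGraph K)

/-- A vertex with three paths of length two attached to it. -/
def T₁ : SimpleGraph (Fin 7) :=
  SimpleGraph.fromEdgeSet {s(0, 1), s(0, 2), s(0, 3), s(1, 4), s(2, 5), s(3, 6)}

/-- A triangle with one pendant edge at each of its three vertices. -/
def T₂ : SimpleGraph (Fin 6) :=
  SimpleGraph.fromEdgeSet {s(0, 1), s(0, 2), s(1, 2), s(0, 3), s(1, 4), s(2, 5)}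

/-! ### The sets `X₁`, `X₂` and `F` -/

/-- The list `l` enumerates the set `S` without repetitions. -/
def Enumerates {γ : Type*} (l : List γ) (S : Set γ) : Prop :=
  l.Nodup ∧ ∀ x, x ∈ l ↔ x ∈ S

/-- The vertices with exactly one neighbour. -/
def X₁ (G : Graph α β) : Set α := {x | x ∈ V(G) ∧ numNeighbors G x = 1}

/-- The condition under which the vertex `x` is added to the current set `X`. -/
def AddVertex (G : Graph α β) (X : Set α) (x : α) : Prop :=
  ∃ y z, y ≠ z ∧ neighborSet G x = {y, z} ∧ commonNeighbors G y z = {x} ∧ G.Adj y z ∧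
    y ∉ X ∧ z ∉ X

/-- The condition under which the edge `e` is added to the current set `F`: the ends of `e` have
a unique common neighbour, this neighbour has degree two, and no edge joining it to an end of `e`
is in `F`. -/
def AddEdge (G : Graph α β) (F : Set β) (e : β) : Prop :=
  ∃ y z x, G.IsLink e y z ∧ commonNeighbors G y z = {x} ∧ numNeighbors G x = 2 ∧
    ∀ e', G.IsLink e' y x ∨ G.IsLink e' x z → e' ∉ F

open Classical in
/-- The result of the greedy procedure that runs through the vertices in the given order. -/
noncomputable def X₂ (G : Graph α β) (vs : List α) : Set α :=
  vs.foldl (fun X x => if AddVertex G X x then insert x X else X) ∅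

open Classical in
/-- The result of the greedy procedure that runs through the edges in the given order. -/
noncomputable def greedyF (G : Graph α β) (es : List β) : Set β :=
  es.foldl (fun F e => if AddEdge G F e then insert e F else F) ∅

/-! ### Disjoint unions of paths -/

/-- `P` consists of pairwise distinct vertices `v 0, …, v p` (`p ≥ 0`), where precisely the
consecutive ones are adjacent; they may be joined by parallel edges. -/
def IsPathGraph (P : Graph α β) : Prop :=
  ∃ (p : ℕ) (v : Fin (p + 1) → α), Function.Injective v ∧ V(P) = Set.range v ∧
    ∀ i j : Fin (p + 1), P.Adj (v i) (v j) ↔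
      (i.val + 1 = j.val ∨ j.val + 1 = i.val)

/-- `H` is the union of pairwise vertex-disjoint paths. -/
def IsDisjointUnionOfPaths (H : Graph α β) : Prop :=
  ∃ C : Set (Graph α β),
    (∀ P ∈ C, P ≤ H ∧ IsPathGraph P) ∧
    (∀ P ∈ C, ∀ Q ∈ C, P ≠ Q → Disjoint V(P) V(Q)) ∧
    V(H) = ⋃ P ∈ C, V(P) ∧ E(H) = ⋃ P ∈ C, E(P)

end DegreeLabeling

namespace DegreeLabeling

universe u v

variable {α : Type u} {β : Type v}

/-! ### Out-degree vectors of an ordered list of arcs -/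

section Abstract

variable {n : ℕ} {E : Type*} [Fintype E]

/-! A labeling turns each edge into an interval of labels, and everything reduces to one geometric
condition. By Hall's theorem a vector of the right total is an out-degree vector exactly when its
sum over each vertex set `S` is at least the number of edges inside `S`. Degree completeness asks
that the dominance bounds (the cases where `S` is an initial or a final segment) and the degree
bounds already imply all these inequalities. `forall_admissible_iff_intervalsDisjoint` shows that
this happens exactly when vertex-disjoint edges span disjoint intervals. Hence (i) says that some
integer function on the vertices separates vertex-disjoint edges (`SeparatesEdges`).

(i) implies (ii): the separation condition can be read on a subgraph, and it fails for `T₁`, `T₂`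
and every cycle of length at least 4.

(ii) implies (iii) and (iv): without `T₂` and 4-cycles every triangle has a tip, that is, a vertex
whose only neighbours are the other two and which is their only common neighbour
(`isTip_of_triangle`). Each greedy procedure therefore destroys all triangles left after deleting
`X₁`; longer cycles are excluded, and three branches at one vertex would give `T₁`. A finite acyclic
graph with at most two neighbours per vertex is a disjoint union of paths.

(iii) or (iv) implies (i): the paths are laid out one after another on the integer line, the deleted
tips are put back between their two neighbours, and the leaves next to theirs
(`exists_separatesEdges_of_core`). An edge then passes over a vertex outside `X₁` only if that
vertex is a tip over this edge, and so never over an end of a disjoint edge. -/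

/-- The sum of `s` over `S` minus the number of edges with both ends in `S`. -/
def excess (t h : E → Fin n) (s : Fin n → ℕ) (S : Finset (Fin n)) : ℤ :=
  ∑ i ∈ S, (s i : ℤ) - ∑ e : E, if t e ∈ S ∧ h e ∈ S then 1 else 0

/-- Vertex-disjoint edges span disjoint intervals of labels. -/
def IntervalsDisjoint (t h : E → Fin n) : Prop :=
  ∀ e e', t e ≠ t e' → t e ≠ h e' → h e ≠ t e' → h e ≠ h e' → h e < t e' ∨ h e' < t e

/-- The numerical hypotheses of degree completeness. -/
structure Admissible (t h : E → Fin n) (s : Fin n → ℕ) : Prop where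
  lower : ∀ k, (Finset.univ.filter fun e => h e ≤ k).card ≤ ∑ i ∈ Finset.Iic k, s i
  upper : ∀ k, ∑ i ∈ Finset.Iic k, s i ≤ (Finset.univ.filter fun e => t e ≤ k).card
  total : ∑ i, s i = Fintype.card E
  degree : ∀ i, s i ≤ (Finset.univ.filter fun e => t e = i ∨ h e = i).card

theorem sum_card_fiber_eq (o : E → Fin n) (S : Finset (Fin n)) :
    ∑ i ∈ S, (Finset.univ.filter fun e => o e = i).card =
      (Finset.univ.filter fun e => o e ∈ S).card := by
  rw [Finset.card_eq_sum_card_fiberwise (f := o) (t := S) (by intro e; simp)]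
  refine Finset.sum_congr rfl fun i hi => ?_
  congr 1
  ext e
  simp only [Finset.mem_filter, Finset.mem_univ, true_and]
  exact ⟨fun h => ⟨h ▸ hi, h⟩, fun h => h.2⟩

/-- Hall's theorem with `s i` copies of each vertex `i`, where every edge has to choose a copy of
one of its ends. For a set `A` of edges the available copies are those over the set `S` of their
ends, and `A` lies inside `S`. A matching gives out-degrees at most `s i`; equal totals force
equality. -/
theorem exists_choice_of_excess_nonneg {t h : E → Fin n} {s : Fin n → ℕ}
    (hs : ∀ S, 0 ≤ excess t h s S) (htot : ∑ i, s i = Fintype.card E) :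
    ∃ o : E → Fin n, (∀ e, o e = t e ∨ o e = h e) ∧
      ∀ i, (Finset.univ.filter fun e => o e = i).card = s i := by
  classical
  let T : E → Finset (Σ i : Fin n, Fin (s i)) := fun e =>
    Finset.univ.filter fun p => p.1 = t e ∨ p.1 = h e
  have hall : ∀ A : Finset E, A.card ≤ (A.biUnion T).card := by
    intro A
    let S : Finset (Fin n) := A.image t ∪ A.image h
    have h1 : A.biUnion T = S.sigma fun _ => Finset.univ := by
      ext ⟨i, j⟩
      simp only [T, S, Finset.mem_biUnion, Finset.mem_filter, Finset.mem_univ, true_and,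
        Finset.mem_sigma, Finset.mem_union, Finset.mem_image, and_true]
      grind
    have h2 : (A.card : ℤ) ≤ ∑ e : E, if t e ∈ S ∧ h e ∈ S then 1 else 0 := by
      rw [Finset.sum_boole]
      norm_cast
      refine Finset.card_le_card fun e he => ?_
      simp only [S, Finset.mem_filter, Finset.mem_univ, true_and, Finset.mem_union,
        Finset.mem_image]
      grind
    have h3 := hs S
    unfold excess at h3
    rw [h1, Finset.card_sigma]
    simp only [Finset.card_univ, Fintype.card_fin]
    zify
    linarith
  obtain ⟨f, hf, hfT⟩ := (Finset.all_card_le_biUnion_card_iff_exists_injective T).1 hall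
  refine ⟨fun e => (f e).1, fun e => by simpa [T] using hfT e, ?_⟩
  have hle : ∀ i ∈ (Finset.univ : Finset (Fin n)),
      (Finset.univ.filter fun e => (f e).1 = i).card ≤ s i := by
    intro i _
    calc (Finset.univ.filter fun e => (f e).1 = i).card
        = ((Finset.univ.filter fun e => (f e).1 = i).image f).card :=
          (Finset.card_image_of_injective _ hf).symm
      _ ≤ (({i} : Finset (Fin n)).sigma fun i => (Finset.univ : Finset (Fin (s i)))).card := by
          refine Finset.card_le_card fun p hp => ?_
          obtain ⟨e, he, rfl⟩ := Finset.mem_image.1 hp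
          simpa using he
      _ = s i := by simp
  have heq := (Finset.sum_eq_sum_iff_of_le hle).1 (by
    rw [sum_card_fiber_eq (fun e => (f e).1), htot]; simp)
  exact fun i => heq i (Finset.mem_univ i)

/-! ### Nonnegativity of the excess under disjoint intervals -/

theorem excess_union {t h : E → Fin n} (s : Fin n → ℕ) {A B : Finset (Fin n)}
    (hAB : Disjoint A B)
    (hE : ∀ e, ¬ (t e ∈ A ∧ h e ∈ B) ∧ ¬ (t e ∈ B ∧ h e ∈ A)) :
    excess t h s (A ∪ B) = excess t h s A + excess t h s B := by
  unfold excess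
  have : (∑ e : E, if t e ∈ A ∪ B ∧ h e ∈ A ∪ B then (1 : ℤ) else 0) =
      (∑ e : E, if t e ∈ A ∧ h e ∈ A then 1 else 0) +
        ∑ e : E, if t e ∈ B ∧ h e ∈ B then 1 else 0 := by
    rw [← Finset.sum_add_distrib]
    refine Finset.sum_congr rfl fun e _ => ?_
    have := hE e
    have hd := Finset.disjoint_left.1 hAB
    have := @hd (t e)
    simp only [Finset.mem_union]
    grind
  rw [Finset.sum_union hAB, this]
  ring

theorem excess_insert {t h : E → Fin n} (hlt : ∀ e, t e < h e) (s : Fin n → ℕ)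
    {S : Finset (Fin n)} {v : Fin n} (hv : v ∉ S)
    (hE : ∀ e, (t e = v → h e ∈ S) ∧ (h e = v → t e ∈ S)) :
    excess t h s S = excess t h s (insert v S) +
      ((Finset.univ.filter fun e => t e = v ∨ h e = v).card - s v) := by
  unfold excess
  have : (∑ e : E, if t e ∈ insert v S ∧ h e ∈ insert v S then (1 : ℤ) else 0) =
      (∑ e : E, if t e ∈ S ∧ h e ∈ S then 1 else 0) +
        (Finset.univ.filter fun e => t e = v ∨ h e = v).card := by
    rw [Finset.card_filter]
    push_cast
    rw [← Finset.sum_add_distrib]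
    refine Finset.sum_congr rfl fun e _ => ?_
    have := hE e
    have := (hlt e).ne
    simp only [Finset.mem_insert]
    grind
  rw [Finset.sum_insert hv, this]
  ring

/-- An edge meeting `P` lies inside `S ∪ P` and not inside `Pᶜ`; an edge avoiding `P` lies inside
`Pᶜ`, and inside `S ∪ P` exactly if inside `S`. So the edge counts of `S ∪ P` and `Pᶜ` add up to
that of `S` plus the number of all edges, which is the total of `s`. -/
theorem excess_split {t h : E → Fin n} {s : Fin n → ℕ} (htot : ∑ i, s i = Fintype.card E)
    {S P : Finset (Fin n)} (hSP : Disjoint S P)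
    (hE : ∀ e, (t e ∈ P → h e ∈ S ∪ P) ∧ (h e ∈ P → t e ∈ S ∪ P)) :
    excess t h s S = excess t h s (S ∪ P) + excess t h s Pᶜ := by
  unfold excess
  have h1 : (∑ e : E, if t e ∈ S ∪ P ∧ h e ∈ S ∪ P then (1 : ℤ) else 0) +
      (∑ e : E, if t e ∈ Pᶜ ∧ h e ∈ Pᶜ then (1 : ℤ) else 0) =
      (∑ e : E, if t e ∈ S ∧ h e ∈ S then 1 else 0) + ∑ e : E, 1 := by
    rw [← Finset.sum_add_distrib, ← Finset.sum_add_distrib]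
    refine Finset.sum_congr rfl fun e _ => ?_
    have := hE e
    have hd := Finset.disjoint_left.1 hSP
    have := @hd (t e)
    have := @hd (h e)
    clear hd
    simp only [Finset.mem_union, Finset.mem_compl] at *
    grind
  have h2 : (∑ i, (s i : ℤ)) = ∑ e : E, (1 : ℤ) := by
    simp only [Finset.sum_const, Finset.card_univ, nsmul_eq_mul, mul_one]
    exact_mod_cast htot
  have h3 := Finset.sum_add_sum_compl P fun i => (s i : ℤ)
  rw [Finset.sum_union hSP]
  linarith

theorem Admissible.excess_prefix {t h : E → Fin n} (hlt : ∀ e, t e < h e) {s : Fin n → ℕ}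
    (hs : Admissible t h s) (v : Fin n) : 0 ≤ excess t h s (Finset.Iio v) := by
  rcases v with ⟨_ | k, hk⟩
  · have : Finset.Iio (⟨0, hk⟩ : Fin n) = ∅ := by
      ext i; simp [Fin.lt_def]
    simp [this, excess]
  · have hP : Finset.Iio (⟨k + 1, hk⟩ : Fin n) = Finset.Iic ⟨k, by omega⟩ := by
      ext i; simp only [Finset.mem_Iio, Finset.mem_Iic, Fin.lt_def, Fin.le_def]; omega
    have h1 := hs.lower ⟨k, by omega⟩
    unfold excess
    rw [hP, Finset.sum_boole]
    have h2 : (Finset.univ.filter fun e => t e ∈ Finset.Iic (⟨k, by omega⟩ : Fin n) ∧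
        h e ∈ Finset.Iic (⟨k, by omega⟩ : Fin n)) =
        Finset.univ.filter fun e => h e ≤ ⟨k, by omega⟩ := by
      ext e
      have := hlt e
      simp only [Finset.mem_filter, Finset.mem_univ, true_and, Finset.mem_Iic]
      exact ⟨fun h => h.2, fun h => ⟨this.le.trans h, h⟩⟩
    rw [h2]
    zify at h1
    linarith

theorem Admissible.excess_suffix {t h : E → Fin n} (hlt : ∀ e, t e < h e) {s : Fin n → ℕ}
    (hs : Admissible t h s) (v : Fin n) : 0 ≤ excess t h s (Finset.Iio v)ᶜ := by
  have key : ∑ i ∈ Finset.Iio v, s i ≤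
      (Finset.univ.filter fun e => t e ∈ Finset.Iio v).card := by
    rcases v with ⟨_ | k, hk⟩
    · have : Finset.Iio (⟨0, hk⟩ : Fin n) = ∅ := by
        ext i; simp [Fin.lt_def]
      simp [this]
    · have hP : Finset.Iio (⟨k + 1, hk⟩ : Fin n) = Finset.Iic ⟨k, by omega⟩ := by
        ext i; simp only [Finset.mem_Iio, Finset.mem_Iic, Fin.lt_def, Fin.le_def]; omega
      rw [hP]
      simpa using hs.upper ⟨k, by omega⟩
  have h1 := Finset.sum_add_sum_compl (Finset.Iio v) s
  have h2 : (∑ e : E, if t e ∈ (Finset.Iio v)ᶜ ∧ h e ∈ (Finset.Iio v)ᶜ then (1 : ℤ) else 0) =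
      Fintype.card E - (Finset.univ.filter fun e => t e ∈ Finset.Iio v).card := by
    rw [eq_sub_iff_add_eq, Finset.card_filter]
    push_cast
    rw [← Finset.sum_add_distrib]
    trans ∑ e : E, (1 : ℤ)
    · refine Finset.sum_congr rfl fun e _ => ?_
      have := hlt e
      simp only [Finset.mem_compl, Finset.mem_Iio]
      split_ifs <;> grind
    · simp
  unfold excess
  rw [h2]
  have := hs.total
  zify at *
  linarith

/-- Induction over sets `S` that contain all, or none, of the first `k` vertices, with `k`
decreasing from `n`. If vertex `k` breaks the pattern, there are two possibilities. Either it can be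
added to or removed from `S` at no cost, by the degree bound or by `s v ≥ 0`; or an edge starting at
`k` blocks all edges from the prefix across `k` that would hinder cutting `S` at `k`. In the second
case one piece is an initial or final segment, handled by dominance, and the other satisfies the
induction hypothesis for `k + 1`. -/
theorem Admissible.excess_nonneg {t h : E → Fin n} (hlt : ∀ e, t e < h e)
    (hd : IntervalsDisjoint t h) {s : Fin n → ℕ} (hs : Admissible t h s)
    (S : Finset (Fin n)) : 0 ≤ excess t h s S := by
  have main : ∀ j k : ℕ, j + k = n → ∀ S : Finset (Fin n),
      ((∀ i : Fin n, i.val < k → i ∈ S) ∨ (∀ i : Fin n, i.val < k → i ∉ S)) →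
        0 ≤ excess t h s S := by
    intro j
    induction j with
    | zero =>
      intro k hk S hS
      rcases hS with hS | hS
      · have : S = Finset.univ := by ext i; simpa using hS i (by omega)
        subst this
        have := hs.total
        zify at this
        simp [excess, this]
      · have : S = ∅ := by ext i; simpa using hS i (by omega)
        simp [this, excess]
    | succ j ih =>
      intro k hk S hS
      let v : Fin n := ⟨k, by omega⟩
      have ih' := ih (k + 1) (by omega)
      have hPv : ∀ i : Fin n, i ∈ Finset.Iio v ↔ i.val < k := fun i => by
        simp [v, Fin.lt_def]
      have hcase : ∀ i : Fin n, i.val < k + 1 → i.val < k ∨ i = v := fun i hi => by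
        simp only [v, Fin.ext_iff]; omega
      -- An edge from before `v` to beyond `v` overlaps every edge starting at `v`, so the two must
      -- share their larger end.
      have cross : ∀ e e', (t e).val < k → t e' = v → h e ≠ v → h e ≠ h e' → k ≤ (h e).val →
          False := by
        intro e e' h1 h2 h3 h4 h5
        have h6 := hlt e'
        have h7 : (v : ℕ) = k := rfl
        have h8 : (h e).val ≠ k := fun hh => h3 (Fin.ext hh)
        rcases hd e e' (by rw [h2]; intro h; rw [h] at h1; omega)
          (by
            intro hh
            rw [h2, Fin.lt_def] at h6
            rw [hh] at h1
            omega) (by rwa [h2]) h4 with h | h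
        · rw [h2, Fin.lt_def] at h; omega
        · rw [h2, Fin.lt_def] at h6; rw [Fin.lt_def] at h; omega
      rcases hS with hS | hS
      · by_cases hvS : v ∈ S
        · exact ih' S (Or.inl fun i hi => (hcase i hi).elim (hS i) fun h => h ▸ hvS)
        by_cases hN : ∀ e, t e = v → h e ∈ S
        · rw [excess_insert hlt s hvS]
          · have h1 := hs.degree v
            have h2 := ih' (insert v S) (Or.inl fun i hi => by
              rcases hcase i hi with h | h
              · exact Finset.mem_insert_of_mem (hS i h)
              · simp [h])
            zify at h1
            linarith
          · refine fun e => ⟨hN e, fun he => hS _ ?_⟩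
            have := hlt e
            rw [he, Fin.lt_def] at this
            exact this
        · push Not at hN
          obtain ⟨e', he', hz⟩ := hN
          have hPS : Finset.Iio v ⊆ S := fun i hi => hS i ((hPv i).1 hi)
          have hu : S = Finset.Iio v ∪ (S \ Finset.Iio v) :=
            (Finset.union_sdiff_of_subset hPS).symm
          rw [hu, excess_union s Finset.disjoint_sdiff]
          · refine add_nonneg (hs.excess_prefix hlt v) (ih' _ (Or.inr fun i hi hiS => ?_))
            rw [Finset.mem_sdiff, hPv] at hiS
            rcases hcase i hi with h | h
            · exact hiS.2 h
            · exact hvS (h ▸ hiS.1)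
          · intro e
            have := hlt e
            rw [Finset.mem_sdiff, Finset.mem_sdiff, hPv, hPv]
            refine ⟨fun ⟨h1, h2, h3⟩ => cross e e' h1 he' (fun hh => hvS (hh ▸ h2))
              (fun hh => hz (hh ▸ h2)) (by omega), fun ⟨⟨h1, h2⟩, h3⟩ => ?_⟩
            rw [Fin.lt_def] at this
            omega
      · by_cases hvS : v ∉ S
        · exact ih' S (Or.inr fun i hi => (hcase i hi).elim (hS i) fun h => h ▸ hvS)
        rw [not_not] at hvS
        by_cases hN : ∀ e, t e = v → h e ∉ S
        · have hu : S = {v} ∪ S.erase v := by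
            rw [← Finset.insert_eq, Finset.insert_erase hvS]
          rw [hu, excess_union s (by simp)]
          · refine add_nonneg ?_ (ih' _ (Or.inr fun i hi hiS => ?_))
            · have : ∀ e, ¬ (t e = v ∧ h e = v) := fun e hh => (hlt e).ne (hh.1.trans hh.2.symm)
              simp [excess, this]
            · rw [Finset.mem_erase] at hiS
              rcases hcase i hi with h | h
              · exact hS i h hiS.2
              · exact hiS.1 h
          · intro e
            simp only [Finset.mem_singleton, Finset.mem_erase]
            refine ⟨fun hh => hN e hh.1 hh.2.2, fun hh => hS (t e) ?_ hh.1.2⟩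
            have := hlt e
            rw [hh.2, Fin.lt_def] at this
            exact this
        · push Not at hN
          obtain ⟨e', he', hz⟩ := hN
          have hdis : Disjoint S (Finset.Iio v) :=
            Finset.disjoint_left.2 fun i hi hi' => hS i ((hPv i).1 hi') hi
          rw [excess_split hs.total hdis]
          · refine add_nonneg (ih' _ (Or.inl fun i hi => ?_)) (hs.excess_suffix hlt v)
            rw [Finset.mem_union, hPv]
            rcases hcase i hi with h | h
            · exact Or.inr h
            · exact Or.inl (h ▸ hvS)
          · intro e
            have := hlt e
            rw [Fin.lt_def] at this
            simp only [Finset.mem_union, hPv]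
            refine ⟨fun h1 => ?_, fun h1 => Or.inr (by omega)⟩
            by_contra hcon
            push Not at hcon
            exact cross e e' h1 he' (fun hh => hcon.1 (hh ▸ hvS))
              (fun hh => hcon.1 (hh ▸ hz)) hcon.2
  exact main n 0 (by omega) S (Or.inl fun i hi => absurd hi (by omega))

/-- A vector that is admissible but whose sum over the two ends of an edge is too small. -/
theorem exists_admissible_of_not_intervalsDisjoint {t h : E → Fin n} (hlt : ∀ e, t e < h e)
    (hd : ¬ IntervalsDisjoint t h) :
    ∃ s, Admissible t h s ∧ ∀ o : E → Fin n, (∀ e, o e = t e ∨ o e = h e) →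
      ¬ ∀ i, (Finset.univ.filter fun e => o e = i).card = s i := by
  classical
  obtain ⟨e, e', h1, h2, h3, h4, h5, h6⟩ : ∃ e e', t e ≠ t e' ∧ t e ≠ h e' ∧ h e ≠ t e' ∧
      h e ≠ h e' ∧ t e < h e' ∧ t e' < h e := by
    unfold IntervalsDisjoint at hd
    push Not at hd
    obtain ⟨e, e', h1, h2, h3, h4, h5, h6⟩ := hd
    exact ⟨e, e', h1, h2, h3, h4, lt_of_le_of_ne h6 h2, lt_of_le_of_ne h5 h3.symm⟩
  have hee : e' ≠ e := by rintro rfl; exact h1 rfl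
  have hl := hlt e
  have hl' := hlt e'
  let S : Finset (Fin n) := {t e, h e}
  -- `o` charges every edge between `S` and its complement to the end outside `S`, so the vertices
  -- of `S` carry only the edges inside `S`. Moving the charge of `e` to `h e'`, outside `S`, leaves
  -- one unit too few on `S`.
  let o : E → Fin n := fun a => if t a ∈ S ∧ h a ∉ S then h a else t a
  let o' : E → Fin n := Function.update o e (h e')
  have ho : ∀ a, o a = t a ∨ o a = h a := fun a => by
    simp only [o]; split_ifs <;> simp
  have hoe' : o e' = t e' := by
    simp only [o, S]; rw [if_neg]; simp only [Finset.mem_insert, Finset.mem_singleton]; tauto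
  have ho'e : o' e = h e' := by simp [o']
  have ho'n : ∀ a, a ≠ e → o' a = o a := fun a ha => by simp [o', ha]
  refine ⟨fun i => (Finset.univ.filter fun a => o' a = i).card, ⟨?_, ?_, ?_, ?_⟩, ?_⟩
  · intro k
    rw [sum_card_fiber_eq]
    simp only [Finset.mem_Iic]
    -- Only for these `k` is `e` missing from the count; `e'`, charged to `t e' < h e`, replaces it.
    by_cases hk : h e ≤ k ∧ k < h e'
    · refine (Finset.card_le_card (t := insert e ((Finset.univ.filter fun a => o' a ≤ k).erase e'))
        fun a ha => ?_).trans ?_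
      · simp only [Finset.mem_filter, Finset.mem_univ, true_and] at ha
        simp only [Finset.mem_insert, Finset.mem_erase, Finset.mem_filter, Finset.mem_univ,
          true_and]
        by_cases hae : a = e
        · exact Or.inl hae
        · refine Or.inr ⟨?_, ?_⟩
          · rintro rfl; exact absurd ha (not_le.2 hk.2)
          · rw [ho'n a hae]
            rcases ho a with h | h <;> rw [h]
            · exact (hlt a).le.trans ha
            · exact ha
      · refine (Finset.card_insert_le _ _).trans ?_
        rw [Finset.card_erase_add_one]
        simp only [Finset.mem_filter, Finset.mem_univ, true_and]
        rw [ho'n e' hee, hoe']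
        exact h6.le.trans hk.1
    · refine Finset.card_le_card fun a ha => ?_
      simp only [Finset.mem_filter, Finset.mem_univ, true_and] at ha ⊢
      by_cases hae : a = e
      · subst hae
        rw [ho'e]
        by_contra hcon
        exact hk ⟨ha, not_le.1 hcon⟩
      · rw [ho'n a hae]
        rcases ho a with h | h <;> rw [h]
        · exact (hlt a).le.trans ha
        · exact ha
  · intro k
    rw [sum_card_fiber_eq]
    simp only [Finset.mem_Iic]
    refine Finset.card_le_card fun a ha => ?_
    simp only [Finset.mem_filter, Finset.mem_univ, true_and] at ha ⊢
    by_cases hae : a = e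
    · subst hae
      rw [ho'e] at ha
      exact h5.le.trans ha
    · rw [ho'n a hae] at ha
      rcases ho a with h | h <;> rw [h] at ha
      · exact ha
      · exact (hlt a).le.trans ha
  · rw [sum_card_fiber_eq]
    simp
  · intro i
    -- The vertex `h e'` gains `e`, but its incident edge `e'` is charged to `t e'`, so the degree
    -- bound survives.
    by_cases hi : i = h e'
    · subst hi
      refine (Finset.card_le_card
        (t := insert e ((Finset.univ.filter fun a => t a = h e' ∨ h a = h e').erase e'))
        fun a ha => ?_).trans ?_
      · simp only [Finset.mem_filter, Finset.mem_univ, true_and] at ha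
        simp only [Finset.mem_insert, Finset.mem_erase, Finset.mem_filter, Finset.mem_univ,
          true_and]
        by_cases hae : a = e
        · exact Or.inl hae
        · rw [ho'n a hae] at ha
          refine Or.inr ⟨?_, ?_⟩
          · rintro rfl
            rw [hoe'] at ha
            exact hl'.ne ha
          · rcases ho a with h | h <;> rw [h] at ha
            · exact Or.inl ha
            · exact Or.inr ha
      · refine (Finset.card_insert_le _ _).trans ?_
        rw [Finset.card_erase_add_one]
        simp
    · refine Finset.card_le_card fun a ha => ?_
      simp only [Finset.mem_filter, Finset.mem_univ, true_and] at ha ⊢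
      by_cases hae : a = e
      · subst hae
        exact absurd (ha.symm.trans ho'e) hi
      · rw [ho'n a hae] at ha
        rcases ho a with h | h <;> rw [h] at ha
        · exact Or.inl ha
        · exact Or.inr ha
  · intro q hq hcon
    have hsum : ∑ i ∈ S, (Finset.univ.filter fun a => q a = i).card =
        ∑ i ∈ S, (Finset.univ.filter fun a => o' a = i).card :=
      Finset.sum_congr rfl fun i _ => hcon i
    rw [sum_card_fiber_eq, sum_card_fiber_eq] at hsum
    have hlt' : (Finset.univ.filter fun a => o' a ∈ S).card <
        (Finset.univ.filter fun a => q a ∈ S).card := by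
      refine Finset.card_lt_card (Finset.ssubset_iff_of_subset ?_ |>.2 ⟨e, ?_, ?_⟩)
      · intro a ha
        simp only [Finset.mem_filter, Finset.mem_univ, true_and] at ha ⊢
        by_cases hae : a = e
        · subst hae
          rcases hq a with h | h <;> simp [S, h]
        · rw [ho'n a hae] at ha
          have : t a ∈ S ∧ h a ∈ S := by
            simp only [o] at ha
            split_ifs at ha with hc
            · exact absurd ha hc.2
            · by_contra hcon
              exact hc ⟨ha, fun hh => hcon ⟨ha, hh⟩⟩
          rcases hq a with h | h <;> rw [h]
          · exact this.1
          · exact this.2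
      · rcases hq e with h | h <;> simp [S, h]
      · simp only [Finset.mem_filter, Finset.mem_univ, true_and, ho'e, S, Finset.mem_insert,
          Finset.mem_singleton]
        tauto
    omega

theorem forall_admissible_iff_intervalsDisjoint {t h : E → Fin n} (hlt : ∀ e, t e < h e) :
    (∀ s, Admissible t h s → ∃ o : E → Fin n, (∀ e, o e = t e ∨ o e = h e) ∧
      ∀ i, (Finset.univ.filter fun e => o e = i).card = s i) ↔ IntervalsDisjoint t h := by
  constructor
  · intro H
    by_contra hd
    obtain ⟨s, hs, hno⟩ := exists_admissible_of_not_intervalsDisjoint hlt hd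
    obtain ⟨o, ho, hos⟩ := H s hs
    exact hno o ho hos
  · exact fun hd s hs => exists_choice_of_excess_nonneg (hs.excess_nonneg hlt hd) hs.total

end Abstract

/-! ### Degree complete labelings and disjoint edges -/

theorem Orientation.tail_eq_or_eq {G : Graph α β} (D R : Orientation G) (e : E(G)) :
    D.tail e = R.tail e ∨ D.tail e = R.head e := by
  rcases (D.isLink e).left_eq_or_eq (R.isLink e) with h | h
  · exact Or.inl (Subtype.ext h)
  · exact Or.inr (Subtype.ext h)

theorem outDegreeVector_eq_card {G : Graph α β} [Fintype E(G)] (D : Orientation G)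
    (f : Labeling G) (i : Fin V(G).ncard) :
    D.outDegreeVector f i = (Finset.univ.filter fun e => f (D.tail e) = i).card := by
  classical
  unfold Orientation.outDegreeVector Orientation.outDegree
  rw [Set.ncard_eq_toFinset_card']
  congr 1
  ext e
  simp [Equiv.eq_symm_apply]

theorem edgeDegree_eq_card {G : Graph α β} [Fintype E(G)] (R : Orientation G)
    (f : Labeling G) (i : Fin V(G).ncard) :
    edgeDegree G (f.symm i) =
      (Finset.univ.filter fun e => f (R.tail e) = i ∨ f (R.head e) = i).card := by
  classical
  unfold edgeDegree
  have : G.incidenceSet (f.symm i) =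
      Subtype.val '' {e : E(G) | f (R.tail e) = i ∨ f (R.head e) = i} := by
    ext e
    simp only [Graph.mem_incidenceSet, Set.mem_image, Set.mem_ofPred_eq, Subtype.exists,
      exists_and_right, exists_eq_right, ← Equiv.eq_symm_apply]
    constructor
    · intro h
      refine ⟨h.edge_mem, ?_⟩
      rcases h.eq_or_eq_of_isLink (R.isLink ⟨e, h.edge_mem⟩) with h | h
      · exact Or.inl (Subtype.ext h.symm)
      · exact Or.inr (Subtype.ext h.symm)
    · rintro ⟨he, h | h⟩ <;> rw [← h]
      · exact (R.isLink ⟨e, he⟩).inc_left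
      · exact (R.isLink ⟨e, he⟩).inc_right
  rw [this, Set.ncard_image_of_injective _ Subtype.val_injective, Set.ncard_eq_toFinset_card']
  congr 1
  ext e
  simp

theorem isDegreeComplete_iff_intervalsDisjoint (G : Graph α β) [G.Loopless] [Fintype E(G)]
    (f : Labeling G) :
    IsDegreeComplete G f ↔ IntervalsDisjoint (fun e => f ((rightOrientation G f).tail e))
      fun e => f ((rightOrientation G f).head e) := by
  classical
  rw [← forall_admissible_iff_intervalsDisjoint (rightOrientation_lt G f)]
  have hR := fun k => sum_card_fiber_eq (fun e => f ((rightOrientation G f).tail e)) k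
  have hL := fun k => sum_card_fiber_eq (fun e => f ((rightOrientation G f).head e)) k
  refine forall_congr' fun s => ?_
  have hadm : Admissible (fun e => f ((rightOrientation G f).tail e))
      (fun e => f ((rightOrientation G f).head e)) s ↔
      Dominated ((leftOrientation G f).outDegreeVector f) s ∧
      Dominated s ((rightOrientation G f).outDegreeVector f) ∧
      ∀ i, s i ≤ edgeDegree G (f.symm i) := by
    have h1 : ∀ i, (leftOrientation G f).outDegreeVector f i = (Finset.univ.filter fun e =>
        f ((rightOrientation G f).head e) = i).card := fun i => outDegreeVector_eq_card _ f i
    simp only [Dominated, edgeDegree_eq_card (rightOrientation G f), h1,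
      outDegreeVector_eq_card (rightOrientation G f), hL, hR, Finset.mem_Iic, Finset.mem_univ,
      Finset.filter_true, Finset.card_univ]
    constructor
    · rintro ⟨h1, h2, h3, h4⟩
      exact ⟨⟨h1, h3.symm⟩, ⟨h2, h3⟩, h4⟩
    · rintro ⟨⟨h1, h3⟩, ⟨h2, -⟩, h4⟩
      exact ⟨h1, h2, h3.symm, h4⟩
  rw [hadm, and_imp, and_imp]
  refine imp_congr_right fun _ => imp_congr_right fun _ => imp_congr_right fun _ => ?_
  constructor
  · rintro ⟨D, rfl⟩
    refine ⟨fun e => f (D.tail e), fun e => ?_, fun i => (outDegreeVector_eq_card D f i).symm⟩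
    simpa using D.tail_eq_or_eq (rightOrientation G f) e
  · rintro ⟨o, ho, hs⟩
    refine ⟨⟨fun e => if o e = f ((rightOrientation G f).tail e) then
      (rightOrientation G f).tail e else (rightOrientation G f).head e,
      fun e => if o e = f ((rightOrientation G f).tail e) then
      (rightOrientation G f).head e else (rightOrientation G f).tail e, fun e => ?_⟩, ?_⟩
    · have := (rightOrientation G f).isLink e
      split_ifs
      · exact this
      · exact this.symm
    · ext i
      rw [outDegreeVector_eq_card, ← hs i]
      congr 1
      ext e
      simp only [Finset.mem_filter, Finset.mem_univ, true_and]
      have := ho e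
      split_ifs with h
      · rw [h]
      · rw [this.resolve_left h]

/-- The values of `κ` on two vertex-disjoint edges are separated. -/
def SeparatesEdges (G : Graph α β) (κ : α → ℤ) : Prop :=
  ∀ x y z w, G.Adj x y → G.Adj z w → x ≠ z → x ≠ w → y ≠ z → y ≠ w →
    (κ x < κ z ∧ κ x < κ w ∧ κ y < κ z ∧ κ y < κ w) ∨
      (κ z < κ x ∧ κ z < κ y ∧ κ w < κ x ∧ κ w < κ y)

/-- Sorting by `κ` with ties broken arbitrarily. Ties are harmless later, because only strict
inequalities between ends of disjoint edges matter. -/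
theorem exists_labeling_of_key (G : Graph α β) (hV : V(G).Finite) (κ : α → ℤ) :
    ∃ f : Labeling G, ∀ x y : V(G), κ x < κ y → f x < f y := by
  have : Finite V(G) := hV
  let e₀ : V(G) ≃ Fin V(G).ncard := Finite.equivFin V(G)
  let k : Fin V(G).ncard → ℤ := fun i => κ (e₀.symm i)
  refine ⟨e₀.trans (Tuple.sort k).symm, fun x y hxy => ?_⟩
  by_contra! hle
  have := Tuple.monotone_sort k hle
  simp only [Function.comp_apply, Equiv.trans_apply, Equiv.apply_symm_apply, k,
    Equiv.symm_apply_apply] at this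
  omega

theorem hasDegreeCompleteLabeling_iff (G : Graph α β) [G.Loopless] (hV : V(G).Finite)
    (hE : E(G).Finite) : HasDegreeCompleteLabeling G ↔ ∃ κ, SeparatesEdges G κ := by
  classical
  have : Fintype E(G) := hE.fintype
  unfold HasDegreeCompleteLabeling
  simp only [isDegreeComplete_iff_intervalsDisjoint]
  constructor
  · rintro ⟨f, hf⟩
    refine ⟨fun x => if hx : x ∈ V(G) then ((f ⟨x, hx⟩).val : ℤ) else 0, ?_⟩
    rintro x y z w ⟨e, he⟩ ⟨e', he'⟩ h1 h2 h3 h4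
    simp only [he.left_mem, he.right_mem, he'.left_mem, he'.right_mem, dif_pos, Nat.cast_lt]
    have hlt := rightOrientation_lt G f ⟨e, he.edge_mem⟩
    have hlt' := rightOrientation_lt G f ⟨e', he'.edge_mem⟩
    have hl := (rightOrientation G f).isLink ⟨e, he.edge_mem⟩
    have hl' := (rightOrientation G f).isLink ⟨e', he'.edge_mem⟩
    have key := hf ⟨e, he.edge_mem⟩ ⟨e', he'.edge_mem⟩
    beta_reduce at key
    generalize (rightOrientation G f).tail ⟨e, he.edge_mem⟩ = a at *
    generalize (rightOrientation G f).head ⟨e, he.edge_mem⟩ = b at *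
    generalize (rightOrientation G f).tail ⟨e', he'.edge_mem⟩ = c at *
    generalize (rightOrientation G f).head ⟨e', he'.edge_mem⟩ = d at *
    obtain ⟨a, ha⟩ := a
    obtain ⟨b, hb⟩ := b
    obtain ⟨c, hc⟩ := c
    obtain ⟨d, hd⟩ := d
    simp only [ne_eq, EmbeddingLike.apply_eq_iff_eq, Subtype.mk.injEq, Fin.lt_def] at *
    rcases he.eq_and_eq_or_eq_and_eq hl with ⟨rfl, rfl⟩ | ⟨rfl, rfl⟩ <;>
    rcases he'.eq_and_eq_or_eq_and_eq hl' with ⟨rfl, rfl⟩ | ⟨rfl, rfl⟩ <;>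
    · have := key (by tauto) (by tauto) (by tauto) (by tauto)
      omega
  · rintro ⟨κ, hκ⟩
    obtain ⟨f, hf⟩ := exists_labeling_of_key G hV κ
    refine ⟨f, fun e e' h1 h2 h3 h4 => ?_⟩
    have hl := (rightOrientation G f).isLink e
    have hl' := (rightOrientation G f).isLink e'
    have inj : ∀ {a b : V(G)}, f a ≠ f b → (a : α) ≠ b := fun h hab =>
      h (congrArg f (Subtype.ext hab))
    rcases hκ _ _ _ _ hl.adj hl'.adj (inj h1) (inj h2) (inj h3) (inj h4) with h | h
    · exact Or.inl (hf _ _ h.2.2.1)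
    · exact Or.inr (hf _ _ h.2.2.1)

/-! ### Subgraphs isomorphic to a simple graph -/

/-- As `K` is simple, a copy of it arises from an injective homomorphism by selecting one edge of
`G` for each edge of `K`. Since `K` has no isolated vertices, the images are automatically vertices
of `G`. -/
theorem hasSubgraphIsomorphicTo_iff (G : Graph α β) {W : Type}
    (K : SimpleGraph W) (hK : ∀ a, ∃ b, K.Adj a b) :
    HasSubgraphIsomorphicTo G K ↔
      ∃ φ : W → α, Function.Injective φ ∧ ∀ a b, K.Adj a b → G.Adj (φ a) (φ b) := by
  constructor
  · rintro ⟨H, hH, φ, ψ, h⟩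
    refine ⟨fun a => φ.symm ⟨a, Set.mem_univ a⟩, fun a b hab => ?_, fun a b hab => ?_⟩
    · exact congrArg Subtype.val (φ.symm.injective (Subtype.ext hab))
    · have he : s(a, b) ∈ E(Graph.ofSimpleGraph K) := hab
      have := (h (ψ.symm ⟨_, he⟩) (φ.symm ⟨a, Set.mem_univ a⟩) (φ.symm ⟨b, Set.mem_univ b⟩)).2
        (by simpa using hab)
      exact (this.mono hH).adj
  · rintro ⟨φ, hφ, h⟩
    have h' : ∀ p : K.edgeSet, ∃ e, ∀ a b, p.1 = s(a, b) → G.IsLink e (φ a) (φ b) := by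
      rintro ⟨p, hp⟩
      induction p with | h a b =>
      obtain ⟨e, he⟩ := h a b hp
      refine ⟨e, fun c d hcd => ?_⟩
      rcases Sym2.eq_iff.1 hcd with ⟨rfl, rfl⟩ | ⟨rfl, rfl⟩
      · exact he
      · exact he.symm
    choose c hc using h'
    have hcinj : Function.Injective c := by
      rintro ⟨p, hp⟩ ⟨q, hq⟩ hpq
      induction p with | h a b =>
      induction q with | h a' b' =>
      have h1 := hc ⟨_, hp⟩ a b rfl
      have h2 := hc ⟨_, hq⟩ a' b' rfl
      rw [hpq] at h1
      refine Subtype.ext (Sym2.eq_iff.2 ?_)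
      simpa [hφ.eq_iff] using h1.eq_and_eq_or_eq_and_eq h2
    let H : Graph α β := (G.induce (Set.range φ)).restrict (Set.range c)
    have hHl : ∀ e x y, H.IsLink e x y ↔
        e ∈ Set.range c ∧ G.IsLink e x y ∧ x ∈ Set.range φ ∧ y ∈ Set.range φ := by
      intro e x y
      simp [H]
    have hHV : V(H) = Set.range φ := rfl
    have hHE : E(H) = Set.range c := by
      ext e
      constructor
      · intro he
        obtain ⟨x, y, hxy⟩ := H.exists_isLink_of_mem_edgeSet he
        exact ((hHl _ _ _).1 hxy).1
      · rintro ⟨⟨p, hp⟩, rfl⟩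
        induction p with | h a b =>
        exact ((hHl _ _ _).2 ⟨⟨_, rfl⟩, hc ⟨_, hp⟩ a b rfl, ⟨a, rfl⟩, ⟨b, rfl⟩⟩).edge_mem
    refine ⟨H, ⟨?_, fun e x y he => ((hHl _ _ _).1 he).2.1⟩, ?_⟩
    · rw [hHV]
      rintro _ ⟨a, rfl⟩
      obtain ⟨b, hab⟩ := hK a
      exact (h a b hab).left_mem
    · obtain ⟨φ', hφ'⟩ : ∃ φ' : W ≃ V(H), ∀ a, (φ' a).1 = φ a :=
        ⟨(Equiv.ofInjective φ hφ).trans (Equiv.setCongr hHV.symm), fun _ => rfl⟩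
      obtain ⟨c', hc'⟩ : ∃ c' : E(Graph.ofSimpleGraph K) ≃ E(H),
          ∀ p (hp : p ∈ K.edgeSet), (c' ⟨p, hp⟩).1 = c ⟨p, hp⟩ :=
        ⟨(Equiv.ofInjective c hcinj).trans (Equiv.setCongr hHE.symm), fun _ _ => rfl⟩
      obtain ⟨ι, hι⟩ : ∃ ι : W ≃ V(Graph.ofSimpleGraph K), ∀ a, (ι a).1 = a :=
        ⟨(Equiv.Set.univ W).symm, fun _ => rfl⟩
      refine ⟨φ'.symm.trans ι, c'.symm, fun e x y => ?_⟩
      obtain ⟨⟨p, hp⟩, rfl⟩ := c'.surjective e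
      obtain ⟨a, rfl⟩ := φ'.surjective x
      obtain ⟨b, rfl⟩ := φ'.surjective y
      induction p with | h a' b' =>
      have hp' : s(a', b') ∈ K.edgeSet := hp
      simp only [Equiv.trans_apply, Equiv.symm_apply_apply, hι, hφ', hc' _ hp', hHl]
      rw [(hc ⟨_, hp'⟩ a' b' rfl).isLink_iff, Graph.ofSimpleGraph_isLink]
      simp only [Set.mem_range_self, hφ.eq_iff, true_and, and_true, hp', Sym2.eq_iff]

/-! ### The forbidden subgraphs -/

theorem hasSubgraphIsomorphicTo_T₁_iff (G : Graph α β) :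
    HasSubgraphIsomorphicTo G T₁ ↔ ∃ c x y z x' y' z', [c, x, y, z, x', y', z'].Nodup ∧
      G.Adj c x ∧ G.Adj c y ∧ G.Adj c z ∧ G.Adj x x' ∧ G.Adj y y' ∧ G.Adj z z' := by
  rw [hasSubgraphIsomorphicTo_iff G T₁ (by simp only [T₁, SimpleGraph.fromEdgeSet_adj]; decide)]
  constructor
  · rintro ⟨φ, hφ, h⟩
    refine ⟨φ 0, φ 1, φ 2, φ 3, φ 4, φ 5, φ 6, ?_, ?_⟩
    · exact List.Nodup.map (l := [0, 1, 2, 3, 4, 5, 6]) hφ (by decide)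
    · refine ⟨h _ _ ?_, h _ _ ?_, h _ _ ?_, h _ _ ?_, h _ _ ?_, h _ _ ?_⟩ <;> simp [T₁]
  · rintro ⟨c, x, y, z, x', y', z', hnd, h1, h2, h3, h4, h5, h6⟩
    refine ⟨![c, x, y, z, x', y', z'], ?_, fun a b hab => ?_⟩
    · rw [← List.nodup_ofFn]
      simpa using hnd
    · simp only [T₁, SimpleGraph.fromEdgeSet_adj, Set.mem_insert_iff, Set.mem_singleton_iff,
        Sym2.eq_iff] at hab
      rcases hab.1 with h | h | h | h | h | h <;> rcases h with ⟨rfl, rfl⟩ | ⟨rfl, rfl⟩ <;>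
        first | assumption | (apply Graph.Adj.symm; assumption)

theorem hasSubgraphIsomorphicTo_T₂_iff (G : Graph α β) :
    HasSubgraphIsomorphicTo G T₂ ↔ ∃ x y z x' y' z', [x, y, z, x', y', z'].Nodup ∧
      G.Adj x y ∧ G.Adj x z ∧ G.Adj y z ∧ G.Adj x x' ∧ G.Adj y y' ∧ G.Adj z z' := by
  rw [hasSubgraphIsomorphicTo_iff G T₂ (by simp only [T₂, SimpleGraph.fromEdgeSet_adj]; decide)]
  constructor
  · rintro ⟨φ, hφ, h⟩
    refine ⟨φ 0, φ 1, φ 2, φ 3, φ 4, φ 5, ?_, ?_⟩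
    · exact List.Nodup.map (l := [0, 1, 2, 3, 4, 5]) hφ (by decide)
    · refine ⟨h _ _ ?_, h _ _ ?_, h _ _ ?_, h _ _ ?_, h _ _ ?_, h _ _ ?_⟩ <;> simp [T₂]
  · rintro ⟨x, y, z, x', y', z', hnd, h1, h2, h3, h4, h5, h6⟩
    refine ⟨![x, y, z, x', y', z'], ?_, fun a b hab => ?_⟩
    · rw [← List.nodup_ofFn]
      simpa using hnd
    · simp only [T₂, SimpleGraph.fromEdgeSet_adj, Set.mem_insert_iff, Set.mem_singleton_iff,
        Sym2.eq_iff] at hab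
      rcases hab.1 with h | h | h | h | h | h <;> rcases h with ⟨rfl, rfl⟩ | ⟨rfl, rfl⟩ <;>
        first | assumption | (apply Graph.Adj.symm; assumption)

/-- The three outer edges are linearly ordered by `κ`. Both edges from the centre to the other two
branches avoid the middle one, so the centre would lie on both sides of it. -/
theorem SeparatesEdges.not_T₁ {G : Graph α β} {κ : α → ℤ} (hκ : SeparatesEdges G κ) :
    ¬ HasSubgraphIsomorphicTo G T₁ := by
  rw [hasSubgraphIsomorphicTo_T₁_iff]
  rintro ⟨c, x, y, z, x', y', z', hnd, h1, h2, h3, h4, h5, h6⟩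
  simp only [List.nodup_cons, List.mem_cons, List.not_mem_nil, or_false, not_or] at hnd
  have a1 := hκ c x y y' h1 h5 (by grind) (by grind) (by grind) (by grind)
  have a2 := hκ c x z z' h1 h6 (by grind) (by grind) (by grind) (by grind)
  have a3 := hκ c y z z' h2 h6 (by grind) (by grind) (by grind) (by grind)
  have a4 := hκ c y x x' h2 h4 (by grind) (by grind) (by grind) (by grind)
  have a5 := hκ c z x x' h3 h4 (by grind) (by grind) (by grind) (by grind)
  have a6 := hκ c z y y' h3 h5 (by grind) (by grind) (by grind) (by grind)
  clear h1 h2 h3 h4 h5 h6 hnd hκ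
  rcases a1 with a1 | a1 <;> rcases a2 with a2 | a2 <;> rcases a3 with a3 | a3 <;>
    rcases a4 with a4 | a4 <;> omega

/-- The three pendant edges are linearly ordered; the triangle edge joining the two extreme ones
avoids the middle one but would have to cross it. -/
theorem SeparatesEdges.not_T₂ {G : Graph α β} {κ : α → ℤ} (hκ : SeparatesEdges G κ) :
    ¬ HasSubgraphIsomorphicTo G T₂ := by
  rw [hasSubgraphIsomorphicTo_T₂_iff]
  rintro ⟨x, y, z, x', y', z', hnd, h1, h2, h3, h4, h5, h6⟩
  simp only [List.nodup_cons, List.mem_cons, List.not_mem_nil, or_false, not_or] at hnd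
  have a1 := hκ x x' y y' h4 h5 (by grind) (by grind) (by grind) (by grind)
  have a2 := hκ x x' z z' h4 h6 (by grind) (by grind) (by grind) (by grind)
  have a3 := hκ y y' z z' h5 h6 (by grind) (by grind) (by grind) (by grind)
  have a4 := hκ x y z z' h1 h6 (by grind) (by grind) (by grind) (by grind)
  have a5 := hκ x z y y' h2 h5 (by grind) (by grind) (by grind) (by grind)
  have a6 := hκ y z x x' h3 h4 (by grind) (by grind) (by grind) (by grind)
  clear h1 h2 h3 h4 h5 h6 hnd hκ
  rcases a1 with a1 | a1 <;> rcases a2 with a2 | a2 <;> rcases a3 with a3 | a3 <;>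
    rcases a4 with a4 | a4 <;> omega

theorem hasSubgraphIsomorphicTo_cycleGraph_iff (G : Graph α β) (m : ℕ) :
    HasSubgraphIsomorphicTo G (SimpleGraph.cycleGraph (m + 2)) ↔
      ∃ φ : Fin (m + 2) → α, Function.Injective φ ∧ ∀ i, G.Adj (φ i) (φ (i + 1)) := by
  have hadj : ∀ i : Fin (m + 2), (SimpleGraph.cycleGraph (m + 2)).Adj i (i + 1) := fun i => by
    simp [SimpleGraph.cycleGraph_adj]
  rw [hasSubgraphIsomorphicTo_iff _ _ fun i => ⟨i + 1, hadj i⟩]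
  refine exists_congr fun φ => and_congr_right fun _ => ⟨fun h i => h _ _ (hadj i), ?_⟩
  intro h a b hab
  rw [SimpleGraph.cycleGraph_adj] at hab
  rcases hab with hab | hab
  · rw [sub_eq_iff_eq_add'.1 hab]
    exact (h b).symm
  · rw [sub_eq_iff_eq_add'.1 hab]
    exact h a

-- At a vertex `i` with minimal `κ`, comparing the edge from `i` to `i + 1` with the one from `i -
-- 2` to `i - 1` puts `i + 1` below `i - 1`; the mirror image gives the reverse. Length at least 4
-- makes both pairs of edges disjoint.
open scoped Fin.CommRing in
theorem SeparatesEdges.not_cycleGraph {G : Graph α β} {κ : α → ℤ} (hκ : SeparatesEdges G κ)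
    {k : ℕ} (hk : 4 ≤ k) : ¬ HasSubgraphIsomorphicTo G (SimpleGraph.cycleGraph k) := by
  obtain ⟨m, rfl⟩ : ∃ m, k = m + 2 + 2 := ⟨k - 4, by omega⟩
  rw [hasSubgraphIsomorphicTo_cycleGraph_iff]
  rintro ⟨φ, hφ, h⟩
  obtain ⟨i, hi⟩ := Finite.exists_min fun i => κ (φ i)
  have e1 : (1 : Fin (m + 2 + 2)) ≠ 0 := by simp
  have e2 : (2 : Fin (m + 2 + 2)) ≠ 0 := by
    simp only [ne_eq, Fin.ext_iff, Fin.val_zero]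
    rw [show ((2 : Fin (m + 2 + 2)) : ℕ) = 2 % (m + 2 + 2) from rfl, Nat.mod_eq_of_lt] <;> omega
  have e3 : (3 : Fin (m + 2 + 2)) ≠ 0 := by
    simp only [ne_eq, Fin.ext_iff, Fin.val_zero]
    rw [show ((3 : Fin (m + 2 + 2)) : ℕ) = 3 % (m + 2 + 2) from rfl, Nat.mod_eq_of_lt] <;> omega
  have h1 : G.Adj (φ (i - 2)) (φ (i - 1)) := by
    have := h (i - 2)
    rwa [show i - 2 + 1 = i - 1 by ring] at this
  have h2 : G.Adj (φ (i - 1)) (φ i) := by simpa using h (i - 1)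
  have h3 : G.Adj (φ (i + 1)) (φ (i + 2)) := by
    have := h (i + 1)
    rwa [show i + 1 + 1 = i + 2 by ring] at this
  have ne : ∀ {a b : Fin (m + 2 + 2)}, a - b ≠ 0 → φ a ≠ φ b := fun hab hh =>
    hab (sub_eq_zero.2 (hφ hh))
  have a1 := hκ _ _ _ _ (h i) h1 (ne (by ring_nf; exact e2)) (ne (by ring_nf; exact e1))
    (ne (by ring_nf; exact e3)) (ne (by ring_nf; exact e2))
  have a2 := hκ _ _ _ _ h3 h2 (ne (by ring_nf; exact e2)) (ne (by ring_nf; exact e1))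
    (ne (by ring_nf; exact e3)) (ne (by ring_nf; exact e2))
  have := hi (i - 1)
  have := hi (i - 2)
  have := hi (i + 1)
  have := hi (i + 2)
  omega

/-! ### Disjoint unions of paths -/

theorem IsPathGraph.exists_index {P : Graph α β} (hP : IsPathGraph P) :
    V(P).Nonempty ∧ ∃ k : α → ℕ, (∀ x ∈ V(P), k x < V(P).ncard) ∧
      (∀ x ∈ V(P), ∀ y ∈ V(P), k x = k y → x = y) ∧
      ∀ x y, P.Adj x y → k x + 1 = k y ∨ k y + 1 = k x := by
  obtain ⟨p, v, hinj, hrange, hadj⟩ := hP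
  have hcard : V(P).ncard = p + 1 := by
    rw [hrange, ← Set.image_univ, Set.ncard_image_of_injective _ hinj, Set.ncard_univ,
      Nat.card_fin]
  have hk : ∀ i, (Function.invFun v (v i)) = i := Function.leftInverse_invFun hinj
  rw [hcard, hrange]
  refine ⟨⟨v 0, 0, rfl⟩, fun x => (Function.invFun v x).val, ?_, ?_, ?_⟩
  · exact fun x _ => Fin.isLt _
  · rintro _ ⟨i, rfl⟩ _ ⟨j, rfl⟩ hij
    beta_reduce at hij
    rw [hk, hk] at hij
    rw [Fin.ext hij]
  · intro x y hxy
    have hx := hxy.left_mem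
    have hy := hxy.right_mem
    rw [hrange] at hx hy
    obtain ⟨i, rfl⟩ := hx
    obtain ⟨j, rfl⟩ := hy
    beta_reduce
    rw [hk, hk]
    exact (hadj i j).1 hxy

theorem IsDisjointUnionOfPaths.exists_position {H : Graph α β} (hV : V(H).Finite)
    (hH : IsDisjointUnionOfPaths H) :
    ∃ σ : α → ℤ, (∀ x, 0 ≤ σ x) ∧ (∀ x ∈ V(H), ∀ y ∈ V(H), σ x = σ y → x = y) ∧
      ∀ x y, H.Adj x y → σ x + 1 = σ y ∨ σ y + 1 = σ x := by
  classical
  obtain ⟨C, hC, hdis, hVC, hEC⟩ := hH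
  have hle := fun P hP => (hC P hP).1
  have : Finite V(H) := hV
  let ι₀ : V(H) ≃ Fin V(H).ncard := Finite.equivFin V(H)
  let ι : α → ℕ := fun x => if hx : x ∈ V(H) then (ι₀ ⟨x, hx⟩).val else 0
  have hι : ∀ x ∈ V(H), ∀ y ∈ V(H), ι x = ι y → x = y := by
    intro x hx y hy hxy
    simp only [ι, hx, hy, dif_pos] at hxy
    exact congrArg Subtype.val (ι₀.injective (Fin.ext hxy))
  have hidx := fun P hP => (hC P hP).2.exists_index
  choose! hnonempty k hbound hinj hadj using hidx
  -- The least index of a vertex identifies a path of the family, since the paths are disjoint and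
  -- nonempty.
  let r : Graph α β → ℕ := fun P => sInf (ι '' V(P))
  have huniq : ∀ P ∈ C, ∀ P' ∈ C, ∀ x, x ∈ V(P) → x ∈ V(P') → P = P' := by
    intro P hP P' hP' x hx hx'
    by_contra hne
    exact Set.disjoint_left.1 (hdis P hP P' hP' hne) hx hx'
  have hr : ∀ P ∈ C, ∀ P' ∈ C, r P = r P' → P = P' := by
    intro P hP P' hP' h
    obtain ⟨x, hx, hxr⟩ := Nat.sInf_mem ((hnonempty P hP).image ι)
    obtain ⟨y, hy, hyr⟩ := Nat.sInf_mem ((hnonempty P' hP').image ι)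
    have := hι x ((hle P hP).vertexSet_mono hx) y ((hle P' hP').vertexSet_mono hy)
      (hxr.trans (h.trans hyr.symm))
    subst this
    exact huniq P hP P' hP' x hx hy
  have hex : ∀ x, ∃ P, x ∈ V(H) → P ∈ C ∧ x ∈ V(P) := by
    intro x
    by_cases hx : x ∈ V(H)
    · rw [hVC] at hx
      simp only [Set.mem_iUnion] at hx
      obtain ⟨P, hP, hxP⟩ := hx
      exact ⟨P, fun _ => ⟨hP, hxP⟩⟩
    · exact ⟨H, fun h => absurd h hx⟩
  choose Q hQ using hex
  -- Each path gets its own block of `V(H).ncard` integers, long enough for any path in `H`.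
  refine ⟨fun x => ((r (Q x) * V(H).ncard + k (Q x) x : ℕ) : ℤ), fun x => by positivity,
    fun x hx y hy hxy => ?_, ?_⟩
  · obtain ⟨hxC, hxP⟩ := hQ x hx
    obtain ⟨hyC, hyP⟩ := hQ y hy
    have hxb := (hbound _ hxC x hxP).trans_le
      (Set.ncard_le_ncard (hle _ hxC).vertexSet_mono hV)
    have hyb := (hbound _ hyC y hyP).trans_le
      (Set.ncard_le_ncard (hle _ hyC).vertexSet_mono hV)
    beta_reduce at hxy
    have hxy' : r (Q x) * V(H).ncard + k (Q x) x = r (Q y) * V(H).ncard + k (Q y) y := by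
      exact_mod_cast hxy
    have e1 : r (Q x) = r (Q y) := by
      have hpos : 0 < V(H).ncard := by omega
      have := congrArg (· / V(H).ncard) hxy'
      simpa only [Nat.mul_add_div hpos, mul_comm _ V(H).ncard, Nat.div_eq_of_lt hxb,
        Nat.div_eq_of_lt hyb, add_zero] using this
    have e2 : k (Q x) x = k (Q y) y := by rw [e1] at hxy'; omega
    have e3 := hr _ hxC _ hyC e1
    rw [e3] at hxP hxC e2
    exact hinj _ hxC x hxP y hyP e2
  · rintro x y ⟨e, he⟩
    have heE := he.edge_mem
    rw [hEC] at heE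
    simp only [Set.mem_iUnion] at heE
    obtain ⟨P, hP, heP⟩ := heE
    have hl : P.IsLink e x y := ((hC P hP).1.isLink_iff heP).2 he
    obtain ⟨hxC, hxP⟩ := hQ x he.left_mem
    obtain ⟨hyC, hyP⟩ := hQ y he.right_mem
    have hx := huniq _ hxC _ hP x hxP hl.left_mem
    have hy := huniq _ hyC _ hP y hyP hl.right_mem
    have := hadj P hP x y hl.adj
    beta_reduce
    rw [hx, hy]
    push_cast
    omega

/-! ### Acyclic graphs with at most two neighbours per vertex -/

/-- The vertices `v 0, …, v p` are distinct and consecutive ones are adjacent. -/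
structure IsPath (H : Graph α β) (p : ℕ) (v : ℕ → α) : Prop where
  inj : ∀ i ≤ p, ∀ j ≤ p, v i = v j → i = j
  mem : ∀ i ≤ p, v i ∈ V(H)
  adj : ∀ i < p, H.Adj (v i) (v (i + 1))

/-- A path such that every neighbour of a vertex of the path is next to it on the path. -/
def IsClosedPath (H : Graph α β) (p : ℕ) (v : ℕ → α) : Prop :=
  IsPath H p v ∧ ∀ i ≤ p, ∀ w, H.Adj (v i) w → ∃ j ≤ p, w = v j ∧ (i + 1 = j ∨ j + 1 = i)

theorem IsPath.reverse {H : Graph α β} {p : ℕ} {v : ℕ → α} (h : IsPath H p v) :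
    IsPath H p fun i => v (p - i) where
  inj i hi j hj hij := by have := h.inj _ (Nat.sub_le p i) _ (Nat.sub_le p j) hij; omega
  mem i _ := h.mem _ (Nat.sub_le p i)
  adj i hi := by
    have := h.adj (p - (i + 1)) (by omega)
    rw [show p - (i + 1) + 1 = p - i by omega] at this
    exact this.symm

theorem IsPath.length_lt {H : Graph α β} (hV : V(H).Finite) {p : ℕ} {v : ℕ → α}
    (h : IsPath H p v) : p < V(H).ncard := by
  have h1 : (v '' Set.Iic p).ncard = p + 1 := by
    have hinj : Set.InjOn v (Set.Iic p) := fun i hi j hj hij => h.inj i hi j hj hij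
    rw [hinj.ncard_image]
    simp [Set.ncard_eq_toFinset_card']
  have h2 : v '' Set.Iic p ⊆ V(H) := by
    rintro _ ⟨i, hi, rfl⟩
    exact h.mem i hi
  have := Set.ncard_le_ncard h2 hV
  omega

theorem IsPath.subset_of_mem {H : Graph α β} {p : ℕ} {v : ℕ → α} (h : IsPath H p v) {S : Set α}
    (hS : ∀ x ∈ S, ∀ y, H.Adj x y → y ∈ S) {i : ℕ} (hi : i ≤ p) (hvi : v i ∈ S) :
    v '' Set.Iic p ⊆ S := by
  have up : ∀ j, i + j ≤ p → v (i + j) ∈ S := by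
    intro j
    induction j with
    | zero => exact fun _ => hvi
    | succ j ih => exact fun hj => hS _ (ih (by omega)) _ (h.adj _ (by omega))
  have down : ∀ j, j ≤ i → v (i - j) ∈ S := by
    intro j
    induction j with
    | zero => exact fun _ => hvi
    | succ j ih =>
      intro hj
      have := h.adj (i - (j + 1)) (by omega)
      rw [show i - (j + 1) + 1 = i - j by omega] at this
      exact hS _ (ih (by omega)) _ this.symm
  rintro _ ⟨j, hj, rfl⟩
  have hj : j ≤ p := hj
  rcases le_total i j with hij | hij
  · have := up (j - i) (by omega)
    rwa [show i + (j - i) = j by omega] at this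
  · have := down (i - j) (by omega)
    rwa [show i - (i - j) = j by omega] at this

/-- There are no cycles of length at least three. -/
def IsAcyclic (H : Graph α β) : Prop :=
  ∀ p v, 2 ≤ p → IsPath H p v → ¬ H.Adj (v p) (v 0)

/-- A neighbour of the last vertex that is off the path would extend it, and one further back on the
path than the predecessor would close a cycle. -/
theorem IsPath.last_of_maximal {H : Graph α β} (hne : ∀ x, ¬ H.Adj x x) (hac : IsAcyclic H)
    {p : ℕ} {v : ℕ → α} (h : IsPath H p v)
    (hmax : ∀ w, (∀ i ≤ p, w i = v i) → ¬ IsPath H (p + 1) w) {w : α} (hw : H.Adj (v p) w) :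
    ∃ j ≤ p, w = v j ∧ j + 1 = p := by
  by_cases hin : ∃ j ≤ p, w = v j
  · obtain ⟨j, hj, rfl⟩ := hin
    refine ⟨j, hj, rfl, ?_⟩
    have hjp : j ≠ p := by rintro rfl; exact hne _ hw
    by_contra hcon
    refine hac (p - j) (fun i => v (j + i)) (by omega) ⟨fun i hi k hk hik => ?_, fun i hi => ?_,
      fun i hi => ?_⟩ ?_
    · have := h.inj _ (by omega) _ (by omega) hik
      omega
    · exact h.mem _ (by omega)
    · exact h.adj _ (by omega)
    · simpa [show j + (p - j) = p by omega] using hw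
  · push Not at hin
    exfalso
    let v' : ℕ → α := fun i => if i ≤ p then v i else w
    have hv' : ∀ i ≤ p, v' i = v i := fun i hi => by simp [v', hi]
    have hvp : v' (p + 1) = w := by simp [v']
    have hcase : ∀ i ≤ p + 1, i ≤ p ∨ i = p + 1 := fun i hi => by omega
    refine hmax v' hv' ⟨fun i hi j hj hij => ?_, fun i hi => ?_, fun i hi => ?_⟩
    · rcases hcase i hi with hi | rfl <;> rcases hcase j hj with hj | rfl
      · rw [hv' i hi, hv' j hj] at hij
        exact h.inj i hi j hj hij
      · rw [hv' i hi, hvp] at hij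
        exact absurd hij.symm (hin i hi)
      · rw [hv' j hj, hvp] at hij
        exact absurd hij (hin j hj)
      · rfl
    · rcases hcase i hi with hi | rfl
      · rw [hv' i hi]; exact h.mem i hi
      · rw [hvp]; exact hw.right_mem
    · rcases Nat.lt_succ_iff_lt_or_eq.1 hi with hi | rfl
      · rw [hv' i hi.le, hv' _ hi]
        exact h.adj i hi
      · rw [hv' i le_rfl, hvp]
        exact hw

/-- A path through `x` that cannot be lengthened is closed: at its ends by maximality, applied also
to the reversed path, and at inner vertices because two neighbours are already used. -/
theorem exists_isClosedPath {H : Graph α β} (hV : V(H).Finite) (hne : ∀ x, ¬ H.Adj x x)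
    (hac : IsAcyclic H)
    (hdeg : ∀ x a b c, H.Adj x a → H.Adj x b → H.Adj x c → a = b ∨ a = c ∨ b = c)
    {x : α} (hx : x ∈ V(H)) : ∃ p v, IsClosedPath H p v ∧ x ∈ v '' Set.Iic p := by
  classical
  let R : ℕ → Prop := fun p => ∃ v, IsPath H p v ∧ ∃ i ≤ p, v i = x
  have h0 : R 0 := ⟨fun _ => x, ⟨fun i hi j hj _ => by omega, fun _ _ => hx,
    fun i hi => absurd hi (by omega)⟩, 0, le_rfl, rfl⟩
  obtain ⟨p, ⟨v, hv, i₀, hi₀, hvi₀⟩, hmax⟩ : ∃ p, R p ∧ ¬ R (p + 1) := by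
    by_contra! hcon
    have hall : ∀ p, R p := fun p => Nat.rec h0 (fun p hp => hcon p hp) p
    obtain ⟨v, hv, -⟩ := hall V(H).ncard
    exact absurd (hv.length_lt hV) (lt_irrefl _)
  have hlast : ∀ {w}, H.Adj (v p) w → ∃ j ≤ p, w = v j ∧ j + 1 = p := fun hw =>
    hv.last_of_maximal hne hac (fun w hw hp =>
      hmax ⟨w, hp, i₀, by omega, by rw [hw i₀ hi₀, hvi₀]⟩) hw
  have hfirst : ∀ {w}, H.Adj (v 0) w → ∃ j ≤ p, w = v (p - j) ∧ j + 1 = p := fun hw =>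
    hv.reverse.last_of_maximal hne hac (fun w hw hp =>
      hmax ⟨w, hp, p - i₀, by omega, by
        rw [hw _ (Nat.sub_le _ _), show p - (p - i₀) = i₀ by omega, hvi₀]⟩) (by simpa using hw)
  refine ⟨p, v, ⟨hv, fun i hi w hw => ?_⟩, i₀, hi₀, hvi₀⟩
  by_cases hip : i = p
  · subst hip
    obtain ⟨j, hj, rfl, hji⟩ := hlast hw
    exact ⟨j, hj, rfl, Or.inr hji⟩
  by_cases hi0 : i = 0
  · subst hi0
    obtain ⟨j, hj, rfl, hji⟩ := hfirst hw
    exact ⟨p - j, Nat.sub_le _ _, rfl, Or.inl (by omega)⟩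
  have h1 := hv.adj i (by omega)
  have h2 := hv.adj (i - 1) (by omega)
  rw [show i - 1 + 1 = i by omega] at h2
  rcases hdeg _ _ _ _ hw h1 h2.symm with h | h | h
  · exact ⟨i + 1, by omega, h, Or.inl rfl⟩
  · exact ⟨i - 1, by omega, h, Or.inr (by omega)⟩
  · have := hv.inj _ (by omega) _ (by omega) h
    omega

theorem IsClosedPath.isPathGraph {H : Graph α β} {p : ℕ} {v : ℕ → α} (h : IsClosedPath H p v) :
    IsPathGraph (H.induce (v '' Set.Iic p)) := by
  have hlt : ∀ i : Fin (p + 1), i.val ≤ p := fun i => Nat.lt_succ_iff.1 i.2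
  refine ⟨p, fun i => v i, fun i j hij => Fin.ext (h.1.inj i (hlt i) j (hlt j) hij), ?_, ?_⟩
  · ext x
    constructor
    · rintro ⟨i, hi, rfl⟩
      exact ⟨⟨i, Nat.lt_succ_iff.2 hi⟩, rfl⟩
    · rintro ⟨i, rfl⟩
      exact ⟨i, hlt i, rfl⟩
  · intro i j
    have hiff : (H.induce (v '' Set.Iic p)).Adj (v i) (v j) ↔ H.Adj (v i) (v j) :=
      ⟨fun ⟨e, he⟩ => ⟨e, he.1⟩, fun ⟨e, he⟩ => ⟨e, he, ⟨i, hlt i, rfl⟩, ⟨j, hlt j, rfl⟩⟩⟩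
    rw [hiff]
    constructor
    · intro hadj
      obtain ⟨k, hk, hvk, hik⟩ := h.2 i (hlt i) _ hadj
      rwa [h.1.inj _ (hlt j) _ hk hvk]
    · rintro (hij | hij)
      · rw [← hij]
        exact h.1.adj _ (by have := hlt j; omega)
      · rw [← hij]
        exact (h.1.adj _ (by have := hlt i; omega)).symm

theorem IsClosedPath.mem_of_adj {H : Graph α β} {p : ℕ} {v : ℕ → α} (h : IsClosedPath H p v) :
    ∀ x ∈ v '' Set.Iic p, ∀ y, H.Adj x y → y ∈ v '' Set.Iic p := by
  rintro _ ⟨i, hi, rfl⟩ y hy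
  obtain ⟨j, hj, rfl, -⟩ := h.2 i hi y hy
  exact ⟨j, hj, rfl⟩

theorem isDisjointUnionOfPaths_of_isAcyclic {H : Graph α β} (hV : V(H).Finite)
    (hne : ∀ x, ¬ H.Adj x x) (hac : IsAcyclic H)
    (hdeg : ∀ x a b c, H.Adj x a → H.Adj x b → H.Adj x c → a = b ∨ a = c ∨ b = c) :
    IsDisjointUnionOfPaths H := by
  have hcover := fun {x} => exists_isClosedPath (x := x) hV hne hac hdeg
  have hsub : ∀ {p v}, IsClosedPath H p v → v '' Set.Iic p ⊆ V(H) := by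
    rintro p v h _ ⟨i, hi, rfl⟩
    exact h.1.mem i hi
  refine ⟨{P | ∃ p v, IsClosedPath H p v ∧ P = H.induce (v '' Set.Iic p)}, ?_, ?_, ?_, ?_⟩
  · rintro _ ⟨p, v, h, rfl⟩
    exact ⟨Graph.induce_le (hsub h), h.isPathGraph⟩
  · rintro _ ⟨p, v, h, rfl⟩ _ ⟨q, w, h', rfl⟩ hPQ
    rw [Set.disjoint_left]
    intro x hx hx'
    refine hPQ (congrArg H.induce (subset_antisymm ?_ ?_))
    · obtain ⟨i, hi, rfl⟩ := hx
      exact h.1.subset_of_mem h'.mem_of_adj hi hx'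
    · obtain ⟨i, hi, rfl⟩ := hx'
      exact h'.1.subset_of_mem h.mem_of_adj hi hx
  · ext x
    simp only [Set.mem_iUnion]
    constructor
    · intro hx
      obtain ⟨p, v, h, hxv⟩ := hcover hx
      exact ⟨_, ⟨p, v, h, rfl⟩, hxv⟩
    · rintro ⟨_, ⟨p, v, h, rfl⟩, hxv⟩
      exact hsub h hxv
  · ext e
    simp only [Set.mem_iUnion]
    constructor
    · intro he
      obtain ⟨x, y, hxy⟩ := H.exists_isLink_of_mem_edgeSet he
      obtain ⟨p, v, h, hxv⟩ := hcover hxy.left_mem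
      exact ⟨_, ⟨p, v, h, rfl⟩, x, y, hxy, hxv, h.mem_of_adj x hxv y hxy.adj⟩
    · rintro ⟨_, ⟨p, v, h, rfl⟩, x, y, hxy, -⟩
      exact hxy.edge_mem

/-! ### The greedy procedures -/

-- Three traces of the run: a rejected element failed the test against a part of the result, an
-- accepted one passed it against such a part, and of two accepted elements the later one passed
-- with the earlier one present.
open Classical in
theorem foldl_greedy_spec {γ : Type*} (add : Set γ → γ → Prop) (l : List γ) :
    let R := l.foldl (fun S x => if add S x then insert x S else S) ∅
    (∀ x ∈ l, x ∉ R → ∃ S ⊆ R, ¬ add S x) ∧ (∀ x ∈ R, ∃ S ⊆ R, add S x) ∧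
      ∀ x ∈ R, ∀ y ∈ R, x ≠ y → ∃ S, (y ∈ S ∧ add S x) ∨ (x ∈ S ∧ add S y) := by
  induction l using List.reverseRecOn with
  | nil => simp
  | append_singleton l a ih =>
    simp only [List.foldl_append, List.foldl_cons, List.foldl_nil] at ih ⊢
    generalize l.foldl (fun S x => if add S x then insert x S else S) ∅ = R at *
    obtain ⟨h1, h2, h3⟩ := ih
    by_cases ha : add R a
    · rw [if_pos ha]
      have hsub : R ⊆ insert a R := Set.subset_insert a R
      refine ⟨fun x hx hxR => ?_, fun x hx => ?_, fun x hx y hy hxy => ?_⟩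
      · rw [Set.mem_insert_iff, not_or] at hxR
        have hxl : x ∈ l := by simpa [hxR.1] using hx
        obtain ⟨S, hS, hadd⟩ := h1 x hxl hxR.2
        exact ⟨S, hS.trans hsub, hadd⟩
      · rcases hx with rfl | hx
        · exact ⟨R, hsub, ha⟩
        · obtain ⟨S, hS, hadd⟩ := h2 x hx
          exact ⟨S, hS.trans hsub, hadd⟩
      · rcases hx with rfl | hx <;> rcases hy with rfl | hy
        · exact absurd rfl hxy
        · exact ⟨R, Or.inl ⟨hy, ha⟩⟩
        · exact ⟨R, Or.inr ⟨hx, ha⟩⟩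
        · exact h3 x hx y hy hxy
    · rw [if_neg ha]
      refine ⟨fun x hx hxR => ?_, h2, h3⟩
      by_cases hxa : x = a
      · subst hxa
        exact ⟨R, subset_rfl, ha⟩
      · exact h1 x (by simpa [hxa] using hx) hxR

/-! ### Tips of triangles and the greedy sets -/

/-- `x` has exactly two neighbours `y` and `z`, these are adjacent, and `x` is their only common
neighbour. -/
structure IsTip (G : Graph α β) (x y z : α) : Prop where
  ne : y ≠ z
  neighborSet_eq : neighborSet G x = {y, z}
  adj : G.Adj y z
  common : commonNeighbors G y z = {x}

namespace IsTip

variable {G : Graph α β} {x y z : α}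

theorem symm (h : IsTip G x y z) : IsTip G x z y where
  ne := h.ne.symm
  neighborSet_eq := by rw [h.neighborSet_eq, Set.pair_comm]
  adj := h.adj.symm
  common := by rw [← h.common, commonNeighbors, commonNeighbors, Set.inter_comm]

theorem adj_iff (h : IsTip G x y z) {w : α} : G.Adj x w ↔ w = y ∨ w = z := by
  change w ∈ neighborSet G x ↔ _
  rw [h.neighborSet_eq]
  rfl

theorem adj_left (h : IsTip G x y z) : G.Adj x y := h.adj_iff.2 (Or.inl rfl)

theorem adj_right (h : IsTip G x y z) : G.Adj x z := h.adj_iff.2 (Or.inr rfl)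

theorem eq_of_adj (h : IsTip G x y z) {w : α} (hy : G.Adj y w) (hz : G.Adj z w) : w = x := by
  have : w ∈ commonNeighbors G y z := ⟨hy, hz⟩
  rwa [h.common] at this

end IsTip

/-- The test only looks at neighbours accepted earlier, but a neighbour accepted later would itself
have failed its test. Hence `X₂` is independent. -/
theorem exists_isTip_of_mem_X₂ {G : Graph α β} [G.Loopless] {vs : List α} {x : α}
    (hx : x ∈ X₂ G vs) : ∃ y z, IsTip G x y z ∧ y ∉ X₂ G vs ∧ z ∉ X₂ G vs := by
  classical
  obtain ⟨-, h2, h3⟩ := foldl_greedy_spec (AddVertex G) vs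
  change ∀ x ∈ X₂ G vs, ∃ S ⊆ X₂ G vs, _ at h2
  change ∀ x ∈ X₂ G vs, ∀ y ∈ X₂ G vs, _ at h3
  have not_mem : ∀ {S : Set α} {a b}, AddVertex G S a → G.Adj a b → b ∉ S := by
    rintro S a b ⟨u, w, -, hN, -, -, hu, hw⟩ hab
    have hb : b ∈ neighborSet G a := hab
    rw [hN] at hb
    rcases hb with rfl | rfl
    · exact hu
    · exact hw
  have key : ∀ w, G.Adj x w → w ∉ X₂ G vs := by
    intro w hxw hw
    obtain ⟨S, ⟨hm, hS⟩ | ⟨hm, hS⟩⟩ := h3 x hx w hw hxw.ne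
    · exact not_mem hS hxw hm
    · exact not_mem hS hxw.symm hm
  obtain ⟨S, -, y, z, hne, hN, hc, hadj, -, -⟩ := h2 x hx
  have h : IsTip G x y z := ⟨hne, hN, hadj, hc⟩
  exact ⟨y, z, h, key y h.adj_left, key z h.adj_right⟩

theorem IsTip.mem_X₂_or {G : Graph α β} {vs : List α} (hvs : Enumerates vs V(G)) {x y z : α}
    (h : IsTip G x y z) (hx : x ∉ X₂ G vs) : y ∈ X₂ G vs ∨ z ∈ X₂ G vs := by
  classical
  obtain ⟨S, hS, hadd⟩ := (foldl_greedy_spec (AddVertex G) vs).1 x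
    ((hvs.2 x).2 h.adj_left.left_mem) hx
  by_contra! hcon
  exact hadd ⟨y, z, h.ne, h.neighborSet_eq, h.common, h.adj, fun hy => hcon.1 (hS hy),
    fun hz => hcon.2 (hS hz)⟩

theorem addEdge_iff {G : Graph α β} [G.Loopless] {F : Set β} {e : β} :
    AddEdge G F e ↔ ∃ y z x, G.IsLink e y z ∧ IsTip G x y z ∧
      ∀ e', G.IsLink e' y x ∨ G.IsLink e' x z → e' ∉ F := by
  constructor
  · rintro ⟨y, z, x, he, hc, hn, hF⟩
    refine ⟨y, z, x, he, ⟨he.ne, ?_, he.adj, hc⟩, hF⟩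
    have hx : x ∈ commonNeighbors G y z := by rw [hc]; rfl
    obtain ⟨u, w, huw, hN⟩ := Set.ncard_eq_two.1 hn
    have hy : y ∈ neighborSet G x := hx.1.symm
    have hz : z ∈ neighborSet G x := hx.2.symm
    have := he.ne
    rw [hN] at hy hz ⊢
    rcases hy with rfl | rfl <;> rcases hz with rfl | rfl
    · exact absurd rfl this
    · rfl
    · exact Set.pair_comm _ _
    · exact absurd rfl this
  · rintro ⟨y, z, x, he, h, hF⟩
    refine ⟨y, z, x, he, h.common, ?_, hF⟩
    rw [numNeighbors, h.neighborSet_eq, Set.ncard_pair h.ne]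

theorem exists_isTip_of_mem_greedyF {G : Graph α β} [G.Loopless] {es : List β} {e : β}
    (he : e ∈ greedyF G es) : ∃ y z x, G.IsLink e y z ∧ IsTip G x y z := by
  classical
  obtain ⟨S, -, hS⟩ := (foldl_greedy_spec (AddEdge G) es).2.1 e he
  obtain ⟨y, z, x, hl, h, -⟩ := addEdge_iff.1 hS
  exact ⟨y, z, x, hl, h⟩

theorem IsTip.exists_mem_greedyF {G : Graph α β} [G.Loopless] {es : List β}
    (hes : Enumerates es E(G)) {x y z : α} {e : β} (h : IsTip G x y z) (hl : G.IsLink e y z)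
    (he : e ∉ greedyF G es) : ∃ e' ∈ greedyF G es, G.IsLink e' y x ∨ G.IsLink e' x z := by
  classical
  obtain ⟨S, hS, hadd⟩ := (foldl_greedy_spec (AddEdge G) es).1 e ((hes.2 e).2 hl.edge_mem) he
  by_contra! hcon
  refine hadd (addEdge_iff.2 ⟨y, z, x, hl, h, fun e' he' hm => ?_⟩)
  rcases he' with he' | he'
  · exact (hcon e' (hS hm)).1 he'
  · exact (hcon e' (hS hm)).2 he'

/-- The greedy edge set does not contain two sides of a triangle. -/
theorem not_mem_greedyF_of_triangle {G : Graph α β} [G.Loopless] {es : List β} {x y z : α}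
    {e e' : β} (hl : G.IsLink e y z) (hl' : G.IsLink e' x z) (hxy : G.Adj x y)
    (he : e ∈ greedyF G es) : e' ∉ greedyF G es := by
  classical
  intro he'
  -- When `a` was accepted, the unique common neighbour of its ends had to be `x`, so the test
  -- inspected `b`.
  have not_mem : ∀ {S : Set β} {a b : β} {x y z : α}, AddEdge G S a → G.IsLink a y z →
      G.IsLink b x z → G.Adj x y → b ∉ S := by
    intro S a b x y z hadd ha hb hxy
    obtain ⟨y', z', x', ha', ht, hS⟩ := addEdge_iff.1 hadd
    rcases ha.eq_and_eq_or_eq_and_eq ha' with ⟨rfl, rfl⟩ | ⟨rfl, rfl⟩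
    · obtain rfl := ht.eq_of_adj hxy.symm hb.symm.adj
      exact hS b (Or.inr hb)
    · obtain rfl := ht.eq_of_adj hb.symm.adj hxy.symm
      exact hS b (Or.inl hb.symm)
  have hne : e ≠ e' := by
    rintro rfl
    exact hxy.ne (hl'.left_unique hl)
  obtain ⟨S, ⟨hm, hS⟩ | ⟨hm, hS⟩⟩ := (foldl_greedy_spec (AddEdge G) es).2.2 e he e' he' hne
  · exact not_mem hS hl hl' hxy hm
  · exact not_mem hS hl' hl hxy.symm hm

/-- An edge blocking `e'` would be a second side, besides `e`, of the same triangle in the greedy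
set. So deleting `greedyF` removes whole adjacencies, not just single parallel edges. -/
theorem mem_greedyF_of_parallel {G : Graph α β} [G.Loopless] {es : List β}
    (hes : Enumerates es E(G)) {y z : α} {e e' : β} (hl : G.IsLink e y z)
    (hl' : G.IsLink e' y z) (he : e ∈ greedyF G es) : e' ∈ greedyF G es := by
  obtain ⟨y', z', x, hl'', ht⟩ := exists_isTip_of_mem_greedyF he
  have ht : IsTip G x y z := by
    rcases hl.eq_and_eq_or_eq_and_eq hl'' with ⟨rfl, rfl⟩ | ⟨rfl, rfl⟩
    · exact ht
    · exact ht.symm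
  by_contra hcon
  obtain ⟨e'', he'', h | h⟩ := ht.exists_mem_greedyF hes hl' hcon
  · exact not_mem_greedyF_of_triangle hl.symm h.symm ht.adj_right he he''
  · exact not_mem_greedyF_of_triangle hl h ht.adj_left he he''

/-! ### Excluding the forbidden subgraphs -/

theorem not_four_cycle {G : Graph α β}
    (hC : ∀ k : ℕ, 4 ≤ k → ¬ HasSubgraphIsomorphicTo G (SimpleGraph.cycleGraph k))
    {a b c d : α} (hnd : [a, b, c, d].Nodup) (h1 : G.Adj a b) (h2 : G.Adj b c) (h3 : G.Adj c d)
    (h4 : G.Adj d a) : False := by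
  refine hC (2 + 2) le_rfl ((hasSubgraphIsomorphicTo_cycleGraph_iff G 2).2
    ⟨![a, b, c, d], ?_, fun i => ?_⟩)
  · rw [← List.nodup_ofFn]
    simpa using hnd
  · fin_cases i
    · exact h1
    · exact h2
    · exact h3
    · exact h4

/-- A triangle vertex that is not a tip has a third neighbour: otherwise another common neighbour of
the other two would close a 4-cycle. Three such outer neighbours are distinct, again by the absence
of 4-cycles, and form a `T₂`. -/
theorem isTip_of_triangle {G : Graph α β} [G.Loopless] (hT : ¬ HasSubgraphIsomorphicTo G T₂)
    (hC : ∀ k : ℕ, 4 ≤ k → ¬ HasSubgraphIsomorphicTo G (SimpleGraph.cycleGraph k))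
    {x y z : α} (hxy : G.Adj x y) (hxz : G.Adj x z) (hyz : G.Adj y z) :
    IsTip G x y z ∨ IsTip G y x z ∨ IsTip G z x y := by
  have key : ∀ {x y z : α}, G.Adj x y → G.Adj x z → G.Adj y z → ¬ IsTip G x y z →
      ∃ x', G.Adj x x' ∧ x' ≠ y ∧ x' ≠ z := by
    intro x y z hxy hxz hyz hn
    by_contra! hcon
    refine hn ⟨hyz.ne, ?_, hyz, ?_⟩
    · ext w
      refine ⟨fun hw => ?_, ?_⟩
      · by_cases hwy : w = y
        · exact Or.inl hwy
        · exact Or.inr (hcon w hw hwy)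
      · rintro (rfl | rfl)
        · exact hxy
        · exact hxz
    · ext w
      refine ⟨fun ⟨hw1, hw2⟩ => ?_, ?_⟩
      · by_contra hwx
        have hwx : w ≠ x := hwx
        refine not_four_cycle hC (a := x) (b := y) (c := w) (d := z) ?_ hxy hw1 hw2.symm hxz.symm
        have := hxy.ne
        have := hxz.ne
        have := hyz.ne
        have h5 : y ≠ w := Graph.Adj.ne hw1
        have h6 : z ≠ w := Graph.Adj.ne hw2
        grind
      · rintro rfl
        exact ⟨hxy.symm, hxz.symm⟩
  by_contra! hcon
  obtain ⟨x', hx, hx1, hx2⟩ := key hxy hxz hyz hcon.1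
  obtain ⟨y', hy, hy1, hy2⟩ := key hxy.symm hyz hxz hcon.2.1
  obtain ⟨z', hz, hz1, hz2⟩ := key hxz.symm hyz.symm hxy hcon.2.2
  have n1 := hxy.ne
  have n2 := hxz.ne
  have n3 := hyz.ne
  have n4 := hx.ne
  have n5 := hy.ne
  have n6 := hz.ne
  have m1 : x' ≠ y' := by
    rintro rfl
    exact not_four_cycle hC (by grind) hx hy.symm hyz hxz.symm
  have m2 : x' ≠ z' := by
    rintro rfl
    exact not_four_cycle hC (by grind) hx hz.symm hyz.symm hxy.symm
  have m3 : y' ≠ z' := by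
    rintro rfl
    exact not_four_cycle hC (by grind) hy hz.symm hxz.symm hxy
  exact hT ((hasSubgraphIsomorphicTo_T₂_iff G).2 ⟨x, y, z, x', y', z', by grind, hxy, hxz, hyz,
    hx, hy, hz⟩)

theorem exists_adj_ne_of_notMem_X₁ {G : Graph α β} {x y : α} (hxy : G.Adj x y)
    (hx : x ∉ X₁ G) : ∃ x', G.Adj x x' ∧ x' ≠ y := by
  by_contra! hcon
  refine hx ⟨hxy.left_mem, ?_⟩
  have : neighborSet G x = {y} := by
    ext w
    refine ⟨fun hw => hcon w hw, ?_⟩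
    rintro rfl
    exact hxy
  rw [numNeighbors, this, Set.ncard_singleton]

/-- No vertex has three pairwise non-adjacent neighbours outside `X₁ G`. -/
theorem not_three_branches {G : Graph α β} [G.Loopless] (hT : ¬ HasSubgraphIsomorphicTo G T₁)
    (hC : ∀ k : ℕ, 4 ≤ k → ¬ HasSubgraphIsomorphicTo G (SimpleGraph.cycleGraph k))
    {c x y z : α} (hx : G.Adj c x) (hy : G.Adj c y) (hz : G.Adj c z) (hxy : x ≠ y) (hxz : x ≠ z)
    (hyz : y ≠ z) (axy : ¬ G.Adj x y) (axz : ¬ G.Adj x z) (ayz : ¬ G.Adj y z) (hx₁ : x ∉ X₁ G)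
    (hy₁ : y ∉ X₁ G) (hz₁ : z ∉ X₁ G) : False := by
  obtain ⟨x', hx', hxc⟩ := exists_adj_ne_of_notMem_X₁ hx.symm hx₁
  obtain ⟨y', hy', hyc⟩ := exists_adj_ne_of_notMem_X₁ hy.symm hy₁
  obtain ⟨z', hz', hzc⟩ := exists_adj_ne_of_notMem_X₁ hz.symm hz₁
  have n1 := hx.ne
  have n2 := hy.ne
  have n3 := hz.ne
  have n4 := hx'.ne
  have n5 := hy'.ne
  have n6 := hz'.ne
  have k1 : x' ≠ y := by rintro rfl; exact axy hx'
  have k2 : x' ≠ z := by rintro rfl; exact axz hx'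
  have k3 : y' ≠ x := by rintro rfl; exact axy hy'.symm
  have k4 : y' ≠ z := by rintro rfl; exact ayz hy'
  have k5 : z' ≠ x := by rintro rfl; exact axz hz'.symm
  have k6 : z' ≠ y := by rintro rfl; exact ayz hz'.symm
  have m1 : x' ≠ y' := by
    rintro rfl
    exact not_four_cycle hC (by grind) hx hx' hy'.symm hy.symm
  have m2 : x' ≠ z' := by
    rintro rfl
    exact not_four_cycle hC (by grind) hx hx' hz'.symm hz.symm
  have m3 : y' ≠ z' := by
    rintro rfl
    exact not_four_cycle hC (by grind) hy hy' hz'.symm hz.symm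
  exact hT ((hasSubgraphIsomorphicTo_T₁_iff G).2 ⟨c, x, y, z, x', y', z', by grind, hx, hy, hz,
    hx', hy', hz'⟩)

theorem isAcyclic_of_no_triangle {G H : Graph α β} (hH : H ≤ G)
    (hC : ∀ k : ℕ, 4 ≤ k → ¬ HasSubgraphIsomorphicTo G (SimpleGraph.cycleGraph k))
    (htri : ∀ x y z, H.Adj x y → H.Adj x z → ¬ H.Adj y z) : IsAcyclic H := by
  intro p v hp hv hadj
  rcases hp.eq_or_lt with rfl | hp
  · exact htri _ _ _ (hv.adj 0 (by omega)) hadj.symm (hv.adj 1 (by omega))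
  · obtain ⟨m, rfl⟩ : ∃ m, p = m + 1 := ⟨p - 1, by omega⟩
    refine hC (m + 2) (by omega) ((hasSubgraphIsomorphicTo_cycleGraph_iff G m).2
      ⟨fun i => v i, fun i j hij => ?_, fun i => ?_⟩)
    · exact Fin.ext (hv.inj _ (Nat.lt_succ_iff.1 i.2) _ (Nat.lt_succ_iff.1 j.2) hij)
    · beta_reduce
      rw [Fin.val_add_one]
      split_ifs with h
      · subst h
        exact hadj.mono hH
      · have : i.val ≠ m + 1 := fun hi => h (Fin.ext hi)
        have := i.2
        exact (hv.adj i (by omega)).mono hH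

theorem isDisjointUnionOfPaths_deleteVerts_X₂ {G : Graph α β} [G.Loopless] (hV : V(G).Finite)
    {vs : List α} (hvs : Enumerates vs V(G)) (hT₁ : ¬ HasSubgraphIsomorphicTo G T₁)
    (hT₂ : ¬ HasSubgraphIsomorphicTo G T₂)
    (hC : ∀ k : ℕ, 4 ≤ k → ¬ HasSubgraphIsomorphicTo G (SimpleGraph.cycleGraph k)) :
    IsDisjointUnionOfPaths ((G.deleteVerts (X₁ G)).deleteVerts (X₂ G vs)) := by
  set H := (G.deleteVerts (X₁ G)).deleteVerts (X₂ G vs) with hHdef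
  have hle : H ≤ G := Graph.deleteVerts_le.trans Graph.deleteVerts_le
  have hadj : ∀ {x y}, H.Adj x y ↔ G.Adj x y ∧ x ∉ X₁ G ∧ y ∉ X₁ G ∧ x ∉ X₂ G vs ∧
      y ∉ X₂ G vs := by
    intro x y
    simp only [Graph.Adj, hHdef, Graph.deleteVerts_isLink]
    grind
  -- The tip of a triangle is in `X₂` or was rejected because of a neighbour in `X₂`, so `X₂` meets
  -- every triangle.
  have htri : ∀ x y z, G.Adj x y → G.Adj x z → G.Adj y z → x ∉ X₂ G vs → y ∉ X₂ G vs →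
      z ∉ X₂ G vs → False := by
    intro x y z hxy hxz hyz hx hy hz
    rcases isTip_of_triangle hT₂ hC hxy hxz hyz with h | h | h
    · exact (h.mem_X₂_or hvs hx).elim hy hz
    · exact (h.mem_X₂_or hvs hy).elim hx hz
    · exact (h.mem_X₂_or hvs hz).elim hx hy
  refine isDisjointUnionOfPaths_of_isAcyclic (hV.subset hle.vertexSet_mono)
    (fun x hx => (hx.mono hle).ne rfl) (isAcyclic_of_no_triangle hle hC ?_) ?_
  · intro x y z hxy hxz hyz
    rw [hadj] at *
    exact htri x y z hxy.1 hxz.1 hyz.1 (by tauto) (by tauto) (by tauto)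
  · intro c x y z hx hy hz
    rw [hadj] at hx hy hz
    by_contra! hcon
    exact not_three_branches hT₁ hC hx.1 hy.1 hz.1 hcon.1 hcon.2.1 hcon.2.2
      (fun h => htri c x y hx.1 hy.1 h (by tauto) (by tauto) (by tauto))
      (fun h => htri c x z hx.1 hz.1 h (by tauto) (by tauto) (by tauto))
      (fun h => htri c y z hy.1 hz.1 h (by tauto) (by tauto) (by tauto))
      (by tauto) (by tauto) (by tauto)

theorem adj_deleteEdges_greedyF_iff {G : Graph α β} [G.Loopless] {es : List β}
    (hes : Enumerates es E(G)) {x y : α} :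
    ((G.deleteVerts (X₁ G)).deleteEdges (greedyF G es)).Adj x y ↔
      G.Adj x y ∧ x ∉ X₁ G ∧ y ∉ X₁ G ∧ ∀ e, G.IsLink e x y → e ∉ greedyF G es := by
  simp only [Graph.Adj, Graph.deleteEdges_isLink, Graph.deleteVerts_isLink]
  constructor
  · rintro ⟨e, ⟨he, hx, hy⟩, heF⟩
    exact ⟨⟨e, he⟩, hx, hy, fun e' he' heF' => heF (mem_greedyF_of_parallel hes he' he heF')⟩
  · rintro ⟨⟨e, he⟩, hx, hy, hF⟩
    exact ⟨e, ⟨he, hx, hy⟩, hF e he⟩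

theorem isDisjointUnionOfPaths_deleteEdges_greedyF {G : Graph α β} [G.Loopless]
    (hV : V(G).Finite) {es : List β} (hes : Enumerates es E(G))
    (hT₁ : ¬ HasSubgraphIsomorphicTo G T₁) (hT₂ : ¬ HasSubgraphIsomorphicTo G T₂)
    (hC : ∀ k : ℕ, 4 ≤ k → ¬ HasSubgraphIsomorphicTo G (SimpleGraph.cycleGraph k)) :
    IsDisjointUnionOfPaths ((G.deleteVerts (X₁ G)).deleteEdges (greedyF G es)) := by
  have hle : (G.deleteVerts (X₁ G)).deleteEdges (greedyF G es) ≤ G :=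
    Graph.deleteEdges_le.trans Graph.deleteVerts_le
  have hF : ∀ {x y}, ((G.deleteVerts (X₁ G)).deleteEdges (greedyF G es)).Adj x y →
      ∀ e, G.IsLink e x y → e ∉ greedyF G es := fun h =>
    ((adj_deleteEdges_greedyF_iff hes).1 h).2.2.2
  have tip : ∀ {x y z}, IsTip G x y z →
      (∀ e, G.IsLink e x y → e ∉ greedyF G es) → (∀ e, G.IsLink e x z → e ∉ greedyF G es) →
      ∃ e ∈ greedyF G es, G.IsLink e y z := by
    intro x y z ht h1 h2
    obtain ⟨e, he⟩ := ht.adj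
    by_contra! hcon
    obtain ⟨e', he', hl | hl⟩ := ht.exists_mem_greedyF hes he fun h => hcon e h he
    · exact h1 e' hl.symm he'
    · exact h2 e' hl he'
  refine isDisjointUnionOfPaths_of_isAcyclic (hV.subset hle.vertexSet_mono)
    (fun x hx => (hx.mono hle).ne rfl) (isAcyclic_of_no_triangle hle hC ?_) ?_
  · intro x y z hxy hxz hyz
    rcases isTip_of_triangle hT₂ hC (hxy.mono hle) (hxz.mono hle) (hyz.mono hle) with h | h | h
    · obtain ⟨e, he, hl⟩ := tip h (hF hxy) (hF hxz)
      exact hF hyz e hl he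
    · obtain ⟨e, he, hl⟩ := tip h (hF hxy.symm) (hF hyz)
      exact hF hxz e hl he
    · obtain ⟨e, he, hl⟩ := tip h (hF hxz.symm) (hF hyz.symm)
      exact hF hxy e hl he
  · intro c x y z hx hy hz
    by_contra! hcon
    obtain ⟨hxy, hxz, hyz⟩ := hcon
    -- If `x` and `y` were adjacent, the triangle on `c`, `x`, `y` would have its tip at `x` or `y`,
    -- as `c` has the third neighbour `z`. An edge of `greedyF` joining `x` and `y` would make `c` a
    -- tip, so there is none; then the side opposite the tip, which is at `c`, would have been
    -- taken.
    have nadj : ∀ {c x y z},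
        ((G.deleteVerts (X₁ G)).deleteEdges (greedyF G es)).Adj c x →
        ((G.deleteVerts (X₁ G)).deleteEdges (greedyF G es)).Adj c y →
        G.Adj c z → z ≠ x → z ≠ y → ¬ G.Adj x y := by
      intro c x y z hx hy hz hzx hzy hadj
      have main : ∀ {x y}, ((G.deleteVerts (X₁ G)).deleteEdges (greedyF G es)).Adj c x →
          ((G.deleteVerts (X₁ G)).deleteEdges (greedyF G es)).Adj c y → z ≠ x → z ≠ y →
          ¬ IsTip G x c y := by
        intro x y hx hy hzx hzy h
        by_cases hxF : ∃ e ∈ greedyF G es, G.IsLink e x y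
        · obtain ⟨e, he, hl⟩ := hxF
          obtain ⟨x', y', c', hl', h'⟩ := exists_isTip_of_mem_greedyF he
          have hc : c' = c := by
            rcases hl.eq_and_eq_or_eq_and_eq hl' with ⟨rfl, rfl⟩ | ⟨rfl, rfl⟩
            · exact (h'.eq_of_adj (hx.mono hle).symm (hy.mono hle).symm).symm
            · exact (h'.eq_of_adj (hy.mono hle).symm (hx.mono hle).symm).symm
          subst hc
          have := h'.adj_iff.1 hz
          rcases hl.eq_and_eq_or_eq_and_eq hl' with ⟨rfl, rfl⟩ | ⟨rfl, rfl⟩ <;> tauto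
        · push Not at hxF
          obtain ⟨e, he, hl⟩ := tip h (hF hx.symm) fun e hl he => hxF e he hl
          exact hF hy e hl he
      rcases isTip_of_triangle hT₂ hC (hx.mono hle) (hy.mono hle) hadj with h | h | h
      · rcases h.adj_iff.1 hz with h | h
        · exact hzx h
        · exact hzy h
      · exact main hx hy hzx hzy h
      · exact main hy hx hzy hzx h
    have hx' := (adj_deleteEdges_greedyF_iff hes).1 hx
    have hy' := (adj_deleteEdges_greedyF_iff hes).1 hy
    have hz' := (adj_deleteEdges_greedyF_iff hes).1 hz
    exact not_three_branches hT₁ hC hx'.1 hy'.1 hz'.1 hxy hxz hyz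
      (nadj hx hy hz'.1 hxz.symm hyz.symm) (nadj hx hz hy'.1 hxy.symm hyz)
      (nadj hy hz hx'.1 hxy hxz) hx'.2.2.1 hy'.2.2.1 hz'.2.2.1

/-! ### Labelings from disjoint unions of paths -/

theorem notMem_X₁_of_adj {G : Graph α β} {x y z : α} (hy : G.Adj x y) (hz : G.Adj x z)
    (hyz : y ≠ z) : x ∉ X₁ G := by
  rintro ⟨-, h⟩
  obtain ⟨w, hw⟩ := Set.ncard_eq_one.1 h
  have hy : y ∈ neighborSet G x := hy
  have hz : z ∈ neighborSet G x := hz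
  rw [hw] at hy hz
  exact hyz (hy.trans hz.symm)

theorem IsTip.notMem_X₁ {G : Graph α β} {x y z : α} (h : IsTip G x y z) : x ∉ X₁ G :=
  notMem_X₁_of_adj h.adj_left h.adj_right h.ne

theorem IsTip.left_notMem_X₁ {G : Graph α β} [G.Loopless] {x y z : α} (h : IsTip G x y z) :
    y ∉ X₁ G :=
  notMem_X₁_of_adj h.adj_left.symm h.adj h.adj_right.ne

/-- `τ` places the vertices outside `X₁`; `hjump` says that an edge passes only over vertices
adjacent to nothing but its own ends. Doubling `τ` makes room for the leaves. -/
theorem exists_separatesEdges_of_core {G : Graph α β} [G.Loopless] (hV : V(G).Finite)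
    (τ : α → ℤ) (hτ : ∀ x, 0 ≤ τ x)
    (hinj : ∀ x ∈ V(G), ∀ y ∈ V(G), x ∉ X₁ G → y ∉ X₁ G → τ x = τ y → x = y)
    (hjump : ∀ p q r, p ∉ X₁ G → q ∉ X₁ G → r ∉ X₁ G → q ∈ V(G) → G.Adj p r → τ p < τ q →
      τ q < τ r → ∀ w, G.Adj q w → w = p ∨ w = r) :
    ∃ κ, SeparatesEdges G κ := by
  classical
  have : Finite V(G) := hV
  obtain ⟨ι, hι⟩ : ∃ ι : α → ℕ, ∀ x ∈ V(G), ∀ y ∈ V(G), ι x = ι y → x = y := by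
    refine ⟨fun x => if hx : x ∈ V(G) then (Finite.equivFin V(G) ⟨x, hx⟩).val else 0, ?_⟩
    intro x hx y hy hxy
    simp only [hx, hy, dif_pos] at hxy
    exact congrArg Subtype.val ((Finite.equivFin V(G)).injective (Fin.ext hxy))
  have hnb : ∀ x, ∃ y, x ∈ X₁ G → ∀ w, G.Adj x w → w = y := by
    intro x
    by_cases hx : x ∈ X₁ G
    · obtain ⟨y, hy⟩ := Set.ncard_eq_one.1 hx.2
      refine ⟨y, fun _ w hw => ?_⟩
      have hw : w ∈ neighborSet G x := hw
      rwa [hy] at hw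
    · exact ⟨x, fun h => absurd h hx⟩
  choose nb hnb using hnb
  -- A leaf follows its neighbour immediately. A component with just two vertices, both in `X₁`,
  -- gets one common negative value, its own by the choice of index, below everything else.
  let κ : α → ℤ := fun x =>
    if x ∉ X₁ G then 2 * τ x
    else if nb x ∉ X₁ G then 2 * τ (nb x) + 1
    else - 1 - min (ι x : ℤ) (ι (nb x))
  -- The normal forms of an edge with its lower end first; every edge has one of them in one of its
  -- two directions.
  let T : α → α → Prop := fun x y =>
    (x ∉ X₁ G ∧ κ x = 2 * τ x ∧ ((y ∉ X₁ G ∧ κ y = 2 * τ y ∧ τ x < τ y) ∨ κ y = 2 * τ x + 1)) ∨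
      (κ x = - 1 - min (ι x : ℤ) (ι y) ∧ κ y = - 1 - min (ι x : ℤ) (ι y))
  have hT : ∀ {x y}, G.Adj x y → T x y ∨ T y x := by
    intro x y hxy
    by_cases hx : x ∈ X₁ G <;> by_cases hy : y ∈ X₁ G
    · have h1 := hnb x hx y hxy
      have h2 := hnb y hy x hxy.symm
      refine Or.inl (Or.inr ⟨?_, ?_⟩)
      · simp [κ, hx, hy, ← h1]
      · simp [κ, hx, hy, ← h2, min_comm]
    · have h1 := hnb x hx y hxy
      exact Or.inr (Or.inl ⟨hy, by simp [κ, hy], Or.inr (by simp [κ, hx, ← h1, hy])⟩)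
    · have h2 := hnb y hy x hxy.symm
      exact Or.inl (Or.inl ⟨hx, by simp [κ, hx], Or.inr (by simp [κ, hy, ← h2, hx])⟩)
    · have hne : τ x ≠ τ y := fun h =>
        hxy.ne (hinj x hxy.left_mem y hxy.right_mem hx hy h)
      have hκx : κ x = 2 * τ x := by simp [κ, hx]
      have hκy : κ y = 2 * τ y := by simp [κ, hy]
      rcases lt_or_gt_of_ne hne with h | h
      · exact Or.inl (Or.inl ⟨hx, hκx, Or.inl ⟨hy, hκy, h⟩⟩)
      · exact Or.inr (Or.inl ⟨hy, hκy, Or.inl ⟨hx, hκx, h⟩⟩)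
  clear_value κ
  have main : ∀ x y z w, G.Adj x y → G.Adj z w → x ≠ z → x ≠ w → y ≠ z → y ≠ w → T x y → T z w →
      (κ x < κ z ∧ κ x < κ w ∧ κ y < κ z ∧ κ y < κ w) ∨
        (κ z < κ x ∧ κ z < κ y ∧ κ w < κ x ∧ κ w < κ y) := by
    intro x y z w hxy hzw h1 h2 h3 h4 t1 t2
    have nx := hτ x
    have nz := hτ z
    rcases t1 with ⟨hx, hκx, t1⟩ | ⟨hκx, hκy⟩ <;> rcases t2 with ⟨hz, hκz, t2⟩ | ⟨hκz, hκw⟩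
    · have hne : τ x ≠ τ z := fun h =>
        h1 (hinj x hxy.left_mem z hzw.left_mem hx hz h)
      -- If two intervals with distinct left ends overlap, the larger left end lies in the other
      -- interval, so `hjump` is only needed for left ends.
      have j1 : y ∉ X₁ G → τ x < τ z → ¬ τ z < τ y := fun hy ha hb =>
        (hjump x z y hx hz hy hzw.left_mem hxy ha hb w hzw).elim h2.symm h4.symm
      have j2 : w ∉ X₁ G → τ z < τ x → ¬ τ x < τ w := fun hw ha hb =>
        (hjump z x w hz hx hw hxy.left_mem hzw ha hb y hxy).elim h3 h4
      have e1 : y ∉ X₁ G → τ y ≠ τ z := fun hy h =>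
        h3 (hinj y hxy.right_mem z hzw.left_mem hy hz h)
      have e2 : w ∉ X₁ G → τ x ≠ τ w := fun hw h =>
        h2 (hinj x hxy.left_mem w hzw.right_mem hx hw h)
      rcases t1 with ⟨hy, hκy, hlt⟩ | hκy <;> rcases t2 with ⟨hw, hκw, hlt'⟩ | hκw
      · have := j1 hy
        have := j2 hw
        have := e1 hy
        have := e2 hw
        omega
      · have := j1 hy
        have := e1 hy
        omega
      · have := j2 hw
        have := e2 hw
        omega
      · omega
    · rcases t1 with ⟨hy, hκy, hlt⟩ | hκy <;> omega
    · rcases t2 with ⟨hw, hκw, hlt⟩ | hκw <;> omega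
    · have i1 : ι x ≠ ι z := fun h => h1 (hι x hxy.left_mem z hzw.left_mem h)
      have i2 : ι x ≠ ι w := fun h => h2 (hι x hxy.left_mem w hzw.right_mem h)
      have i3 : ι y ≠ ι z := fun h => h3 (hι y hxy.right_mem z hzw.left_mem h)
      have i4 : ι y ≠ ι w := fun h => h4 (hι y hxy.right_mem w hzw.right_mem h)
      omega
  refine ⟨κ, fun x y z w hxy hzw h1 h2 h3 h4 => ?_⟩
  rcases hT hxy with t1 | t1 <;> rcases hT hzw with t2 | t2
  · exact main x y z w hxy hzw h1 h2 h3 h4 t1 t2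
  · exact (main x y w z hxy hzw.symm h2 h1 h4 h3 t1 t2).imp (fun ⟨a, b, c, d⟩ => ⟨b, a, d, c⟩)
      fun ⟨a, b, c, d⟩ => ⟨c, d, a, b⟩
  · exact (main y x z w hxy.symm hzw h3 h4 h1 h2 t1 t2).imp (fun ⟨a, b, c, d⟩ => ⟨c, d, a, b⟩)
      fun ⟨a, b, c, d⟩ => ⟨b, a, d, c⟩
  · exact (main y x w z hxy.symm hzw.symm h4 h3 h2 h1 t1 t2).imp
      (fun ⟨a, b, c, d⟩ => ⟨d, c, b, a⟩) fun ⟨a, b, c, d⟩ => ⟨d, c, b, a⟩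

theorem exists_separatesEdges_of_deleteEdges_greedyF {G : Graph α β} [G.Loopless]
    (hV : V(G).Finite) {es : List β} (hes : Enumerates es E(G))
    (hH : IsDisjointUnionOfPaths ((G.deleteVerts (X₁ G)).deleteEdges (greedyF G es))) :
    ∃ κ, SeparatesEdges G κ := by
  have hle : (G.deleteVerts (X₁ G)).deleteEdges (greedyF G es) ≤ G :=
    Graph.deleteEdges_le.trans Graph.deleteVerts_le
  obtain ⟨σ, hσ, hinj, hadj⟩ := hH.exists_position (hV.subset hle.vertexSet_mono)
  have hmem : ∀ {x}, x ∈ V(G) → x ∉ X₁ G →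
      x ∈ V((G.deleteVerts (X₁ G)).deleteEdges (greedyF G es)) := fun hx hx' => ⟨hx, hx'⟩
  refine exists_separatesEdges_of_core hV σ hσ
    (fun x hx y hy hx' hy' => hinj x (hmem hx hx') y (hmem hy hy')) ?_
  intro p q r hp hq hr hqV hpr h1 h2 w hw
  by_cases hF : ∀ e, G.IsLink e p r → e ∉ greedyF G es
  · have := hadj p r ((adj_deleteEdges_greedyF_iff hes).2 ⟨hpr, hp, hr, hF⟩)
    omega
  · push Not at hF
    obtain ⟨e, hl, he⟩ := hF
    obtain ⟨y, z, x, hl', ht⟩ := exists_isTip_of_mem_greedyF he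
    have ht : IsTip G x p r := by
      rcases hl.eq_and_eq_or_eq_and_eq hl' with ⟨rfl, rfl⟩ | ⟨rfl, rfl⟩
      · exact ht
      · exact ht.symm
    -- The other two sides of the triangle survive, so the tip `x` is next to both `p` and `r`, and
    -- its position is the only one between them.
    have a1 := hadj x r ((adj_deleteEdges_greedyF_iff hes).2 ⟨ht.adj_right, ht.notMem_X₁, hr,
      fun e' hl' => not_mem_greedyF_of_triangle hl hl' ht.adj_left he⟩)
    have a2 := hadj x p ((adj_deleteEdges_greedyF_iff hes).2 ⟨ht.adj_left, ht.notMem_X₁, hp,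
      fun e' hl' => not_mem_greedyF_of_triangle hl.symm hl' ht.adj_right he⟩)
    have hqx : q = x := hinj q (hmem hqV hq) x (hmem ht.adj_left.left_mem ht.notMem_X₁) (by omega)
    subst hqx
    exact ht.adj_iff.1 hw

theorem exists_separatesEdges_of_deleteVerts_X₂ {G : Graph α β} [G.Loopless]
    (hV : V(G).Finite) {vs : List α}
    (hH : IsDisjointUnionOfPaths ((G.deleteVerts (X₁ G)).deleteVerts (X₂ G vs))) :
    ∃ κ, SeparatesEdges G κ := by
  classical
  have hle : (G.deleteVerts (X₁ G)).deleteVerts (X₂ G vs) ≤ G :=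
    Graph.deleteVerts_le.trans Graph.deleteVerts_le
  obtain ⟨σ, hσ, hinj, hadj⟩ := hH.exists_position (hV.subset hle.vertexSet_mono)
  have hmem : ∀ {x}, x ∈ V(G) → x ∉ X₁ G → x ∉ X₂ G vs →
      x ∈ V((G.deleteVerts (X₁ G)).deleteVerts (X₂ G vs)) := fun hx h1 h2 => ⟨⟨hx, h1⟩, h2⟩
  have hadj' : ∀ {x y}, G.Adj x y → x ∉ X₁ G → y ∉ X₁ G → x ∉ X₂ G vs → y ∉ X₂ G vs →
      σ x + 1 = σ y ∨ σ y + 1 = σ x := by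
    rintro x y ⟨e, he⟩ h1 h2 h3 h4
    refine hadj x y ⟨e, ?_⟩
    simp only [Graph.deleteVerts_isLink]
    exact ⟨⟨he, h1, h2⟩, h3, h4⟩
  have htip : ∀ x, ∃ y z, x ∈ X₂ G vs →
      IsTip G x y z ∧ y ∉ X₂ G vs ∧ z ∉ X₂ G vs ∧ σ y + 1 = σ z := by
    intro x
    by_cases hx : x ∈ X₂ G vs
    · obtain ⟨y, z, ht, hy, hz⟩ := exists_isTip_of_mem_X₂ hx
      rcases hadj' ht.adj ht.left_notMem_X₁ ht.symm.left_notMem_X₁ hy hz with h | h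
      · exact ⟨y, z, fun _ => ⟨ht, hy, hz, h⟩⟩
      · exact ⟨z, y, fun _ => ⟨ht.symm, hz, hy, h⟩⟩
    · exact ⟨x, x, fun h => absurd h hx⟩
  choose y z htip using htip
  -- The neighbours of a vertex of `X₂` are consecutive on a path; doubling `σ` frees the midpoint
  -- between them. Distinct tips get distinct midpoints, a tip being the only common neighbour of
  -- its two neighbours.
  obtain ⟨τ, hτ₀, hτ₁⟩ : ∃ τ : α → ℤ, (∀ x ∉ X₂ G vs, τ x = 2 * σ x) ∧
      ∀ x ∈ X₂ G vs, τ x = 2 * σ (y x) + 1 :=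
    ⟨fun x => if x ∈ X₂ G vs then 2 * σ (y x) + 1 else 2 * σ x, fun x hx => if_neg hx,
      fun x hx => if_pos hx⟩
  have hymem : ∀ {x}, x ∈ X₂ G vs → y x ∈ V((G.deleteVerts (X₁ G)).deleteVerts (X₂ G vs)) :=
    fun hx => hmem (htip _ hx).1.adj.left_mem (htip _ hx).1.left_notMem_X₁ (htip _ hx).2.1
  have hzmem : ∀ {x}, x ∈ X₂ G vs → z x ∈ V((G.deleteVerts (X₁ G)).deleteVerts (X₂ G vs)) :=
    fun hx => hmem (htip _ hx).1.adj.right_mem (htip _ hx).1.symm.left_notMem_X₁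
      (htip _ hx).2.2.1
  refine exists_separatesEdges_of_core hV τ (fun x => ?_) ?_ ?_
  · have h1 := hσ x
    have h2 := hσ (y x)
    by_cases hx : x ∈ X₂ G vs
    · rw [hτ₁ x hx]; omega
    · rw [hτ₀ x hx]; omega
  · intro a ha b hb ha₁ hb₁ hab
    by_cases ha₂ : a ∈ X₂ G vs <;> by_cases hb₂ : b ∈ X₂ G vs
    · rw [hτ₁ a ha₂, hτ₁ b hb₂] at hab
      obtain ⟨ta, -, -, sa⟩ := htip a ha₂
      obtain ⟨tb, -, -, sb⟩ := htip b hb₂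
      have e1 : y a = y b := hinj _ (hymem ha₂) _ (hymem hb₂) (by omega)
      have e2 : z a = z b := hinj _ (hzmem ha₂) _ (hzmem hb₂) (by omega)
      exact tb.eq_of_adj (e1 ▸ ta.adj_left.symm) (e2 ▸ ta.adj_right.symm)
    · rw [hτ₁ a ha₂, hτ₀ b hb₂] at hab
      omega
    · rw [hτ₀ a ha₂, hτ₁ b hb₂] at hab
      omega
    · rw [hτ₀ a ha₂, hτ₀ b hb₂] at hab
      exact hinj a (hmem ha ha₁ ha₂) b (hmem hb hb₁ hb₂) (by omega)
  · intro p q r hp hq hr hqV hpr h1 h2 w hw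
    -- An edge at a vertex of `X₂` has length 1 and passes over nothing. Any other edge has length 2
    -- and can only pass over the tip at its midpoint.
    by_cases hp₂ : p ∈ X₂ G vs
    · exfalso
      obtain ⟨tp, yp, zp, sp⟩ := htip p hp₂
      have e1 := hτ₁ p hp₂
      have e2 : τ r = 2 * σ (y p) ∨ τ r = 2 * σ (z p) := by
        rcases tp.adj_iff.1 hpr with rfl | rfl
        · exact Or.inl (hτ₀ _ yp)
        · exact Or.inr (hτ₀ _ zp)
      omega
    by_cases hr₂ : r ∈ X₂ G vs
    · exfalso
      obtain ⟨tr, yr, zr, sr⟩ := htip r hr₂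
      have e1 := hτ₁ r hr₂
      have e2 : τ p = 2 * σ (y r) ∨ τ p = 2 * σ (z r) := by
        rcases tr.adj_iff.1 hpr.symm with rfl | rfl
        · exact Or.inl (hτ₀ _ yr)
        · exact Or.inr (hτ₀ _ zr)
      omega
    have e := hadj' hpr hp hr hp₂ hr₂
    rw [hτ₀ p hp₂] at h1
    rw [hτ₀ r hr₂] at h2
    by_cases hq₂ : q ∈ X₂ G vs
    · obtain ⟨tq, yq, zq, sq⟩ := htip q hq₂
      rw [hτ₁ q hq₂] at h1 h2
      have e1 : y q = p := hinj _ (hymem hq₂) _ (hmem hpr.left_mem hp hp₂) (by omega)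
      have e2 : z q = r := hinj _ (hzmem hq₂) _ (hmem hpr.right_mem hr hr₂) (by omega)
      rw [← e1, ← e2]
      exact tq.adj_iff.1 hw
    · rw [hτ₀ q hq₂] at h1 h2
      omega

end DegreeLabeling

theorem mainTheorem1 {α β : Type*} (G : Graph α β) [G.Loopless]
    (hV : V(G).Finite) (hE : E(G).Finite)
    (vs : List α) (hvs : DegreeLabeling.Enumerates vs V(G))
    (es : List β) (hes : DegreeLabeling.Enumerates es E(G)) :
    List.TFAE [
      DegreeLabeling.HasDegreeCompleteLabeling G,
      ¬ DegreeLabeling.HasSubgraphIsomorphicTo G DegreeLabeling.T₁ ∧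
        ¬ DegreeLabeling.HasSubgraphIsomorphicTo G DegreeLabeling.T₂ ∧
        ∀ k : ℕ, 4 ≤ k →
          ¬ DegreeLabeling.HasSubgraphIsomorphicTo G (SimpleGraph.cycleGraph k),
      DegreeLabeling.IsDisjointUnionOfPaths
        ((G.deleteVerts (DegreeLabeling.X₁ G)).deleteVerts (DegreeLabeling.X₂ G vs)),
      DegreeLabeling.IsDisjointUnionOfPaths
        ((G.deleteVerts (DegreeLabeling.X₁ G)).deleteEdges (DegreeLabeling.greedyF G es))] := by
  rw [DegreeLabeling.hasDegreeCompleteLabeling_iff G hV hE]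
  tfae_have 1 → 2 := fun ⟨_, hκ⟩ => ⟨hκ.not_T₁, hκ.not_T₂, fun _ hk => hκ.not_cycleGraph hk⟩
  tfae_have 2 → 3 := fun ⟨h1, h2, h3⟩ =>
    DegreeLabeling.isDisjointUnionOfPaths_deleteVerts_X₂ hV hvs h1 h2 h3
  tfae_have 2 → 4 := fun ⟨h1, h2, h3⟩ =>
    DegreeLabeling.isDisjointUnionOfPaths_deleteEdges_greedyF hV hes h1 h2 h3
  tfae_have 3 → 1 := DegreeLabeling.exists_separatesEdges_of_deleteVerts_X₂ hV
  tfae_have 4 → 1 := DegreeLabeling.exists_separatesEdges_of_deleteEdges_greedyF hV hes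
  tfae_finish
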